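/- **Setting.** Let $\alpha$ be a positive integer, or a complex number with $\operatorname{Re}\alpha>0$ and $\operatorname{Re}\alpha\notin\mathbf Z$ (in particular $\alpha$ may be any positive real number). Put $k=\alpha$ if $\alpha$ is an integer and $k=[\operatorname{Re}\alpha]+1$ otherwise. Let $p\ge 0$, $0=h_0<h_1<\dots<h_p=h<\infty$, $A_0,\dots,A_p\in\mathbf R^{n\times n}$ and $B\in\mathbf R^{n\times m}$. Consider $$({}^{C}D^{\alpha}_{0+}x)(t)=\sum_{i=0}^{p}A_i\,x(t-h_i)+B\,u(t).\tag{1}$$ Here $I^{\beta}f(t)=\frac1{\Gamma(\beta)}\int_0^t(t-\tau)^{\beta-1}f(\tau)\,d\tau$ for $\operatorname{Re}\beta>0$, $I^0f=f$, and $${}^{C}D^{\alpha}_{0+}x=\frac{d^k}{dt^k}\,I^{k-\alpha}\Big[x-\sum_{j=0}^{k-1}\frac{x^{(j)}(0)}{j!}\tau^j\Big].$$ *Data.* The initial functions $\varphi_j:[-h,0]\to\mathbf R^n$ $(0\le j\le k-1)$ are bounded, continuous outside a null set $N_j$, and absolutely continuous on each compact interval contained in $[-h,0]\setminus N_j$;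 write $x_{j0}=\varphi_j(0)$. The control $u:\mathbf R_{0+}\to\mathbf R^m$ is bounded and piecewise continuous (finitely many discontinuities in each bounded interval, with finite one-sided limits). *Solution.* A solution is a function $x:[-h,\infty)\to\mathbf C^n$ such that - $x(t)=\sum_{j=0}^{k-1}\varphi_j(t)$ for $-h\le t<0$ (so $x=\varphi_0$ there if $k=1$); - $x\in C^{k-1}([0,\infty))$ and $x^{(j)}(0)=\varphi_j(0)=x_{j0}$ for $0\le j\le k-1$ (one-sided derivatives at $0$); - $I^{k-\alpha}\big[x-\sum_{j<k}x_{j0}\tau^j/j!\big]$ is $C^{k-1}$ on $[0,\infty)$ with $(k-1)$-st derivative absolutely continuous on $[0,T]$ for every $T\ge 0$, and (1) holds for almost every $t>0$. **Theorem 3.1.** For all such data there is exactly one solution $x_\alpha$ on $[-h,\infty)$. It satisfies (1) at every $t>0$ at which the right-hand side of (1) is continuous, it is $\mathbf R^n$-valued if $\alpha$ is real, and for all $t\in\mathbf R_{0+}$ $$x_\alpha(t)=\sum_{j=0}^{k-1}\Big(\Phi_{\alpha j0}(t)x_{j0}+\sum_{i=1}^{p}\int_0^{h_i}\Phi_\alpha(t-\tau)A_i\varphi_j(\tau-h_i)\,d\tau\Big)+\sum_{i=1}^{p}\int_{h_i}^{t}\Phi_\alpha(t-\tau)A_i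 x_\alpha(\tau-h_i)\,d\tau+\int_0^t\Phi_\alpha(t-\tau)Bu(\tau)\,d\tau,\tag{3.2}$$ where for $t\ge0$ $$\Phi_{\alpha j0}(t)=t^jE_{\alpha,j+1}(A_0t^\alpha),\qquad \Phi_\alpha(t)=t^{\alpha-1}E_{\alpha,\alpha}(A_0t^\alpha),\qquad E_{\alpha,\beta}(Z)=\sum_{\ell=0}^\infty\frac{Z^\ell}{\Gamma(\alpha\ell+\beta)},$$ and $\Phi_{\alpha j0}(t)=\Phi_\alpha(t)=0$ for $t<0$. The series defining these kernels converge for all $t\ge0$, and all integrals in (3.2) exist as Lebesgue integrals. -/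

import Mathlib

open MeasureTheory Set Filter Topology

noncomputable section

namespace CaputoDelay

/-- The admissible orders: `α` is a positive integer, or `Re α > 0` and `Re α` is not an integer.
Every real `α > 0` is admissible. -/
def AdmissibleOrder (α : ℂ) : Prop :=
  (∃ m : ℕ, 0 < m ∧ α = m) ∨ (0 < α.re ∧ ∀ m : ℕ, α.re ≠ m)

open Classical in
/-- The integer `k` of the order `α`: `k = α` if `α` is a natural number,
`k = [Re α] + 1` otherwise. -/
def caputoIndex (α : ℂ) : ℕ :=
  if ∃ m : ℕ, α = m then ⌊α.re⌋₊ else ⌊α.re⌋₊ + 1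

open Classical in
/-- Riemann-Liouville fractional integral of order `β` based at `0`,
`(I^β f)(t) = Γ(β)⁻¹ ∫₀ᵗ (t - τ)^(β - 1) f(τ) dτ`, with `I^0 f = f`. -/
def fracIntegral {n : ℕ} (β : ℂ) (f : ℝ → Fin n → ℂ) (t : ℝ) : Fin n → ℂ :=
  if β = 0 then f t
  else (Complex.Gamma β)⁻¹ • ∫ τ in (0 : ℝ)..t, (((t - τ : ℝ) : ℂ) ^ (β - 1)) • f τ

/-- The `j`-th (one-sided at `0`) derivative of `x` on `[0, ∞)`. -/
def derivHalfLine {n : ℕ} (j : ℕ) (x : ℝ → Fin n → ℂ) (t : ℝ) : Fin n → ℂ :=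
  iteratedDerivWithin j x (Ici 0) t

/-- Taylor polynomial of `x` at `0` of degree `< k`: `∑_{j<k} x^(j)(0) t^j / j!`. -/
def taylorPart {n : ℕ} (k : ℕ) (x : ℝ → Fin n → ℂ) (t : ℝ) : Fin n → ℂ :=
  ∑ j ∈ Finset.range k, ((t : ℂ) ^ j / (j.factorial : ℂ)) • derivHalfLine j x 0

/-- `I^(k - α) [x - ∑_{j<k} x^(j)(0) t^j / j!]`, the function whose `k`-th derivative is the Caputo
derivative of `x` of order `α`. -/
def caputoIntegral {n : ℕ} (α : ℂ) (x : ℝ → Fin n → ℂ) : ℝ → Fin n → ℂ :=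
  fracIntegral ((caputoIndex α : ℂ) - α) (fun τ => x τ - taylorPart (caputoIndex α) x τ)

/-- The `(k - 1)`-st derivative of `caputoIntegral α x` on `[0, ∞)`. -/
def caputoPrimitive {n : ℕ} (α : ℂ) (x : ℝ → Fin n → ℂ) : ℝ → Fin n → ℂ :=
  derivHalfLine (caputoIndex α - 1) (caputoIntegral α x)

/-- At `t > 0` the Caputo derivative of `x` of order `α` based at `0` exists and equals `v`. It is
the Riemann-Liouville derivative of `x` minus its Taylor polynomial, that is
`v = (d/dt)^k I^(k - α) [x - ∑_{j<k} x^(j)(0) t^j / j!] (t)`. -/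
def HasCaputoDerivAt {n : ℕ} (α : ℂ) (x : ℝ → Fin n → ℂ) (v : Fin n → ℂ) (t : ℝ) : Prop :=
  HasDerivAt (caputoPrimitive α x) v t

/-- The regularity class in which the Caputo derivative is taken: `x ∈ C^(k-1)([0, ∞))` and
`I^(k - α) [x - ∑_{j<k} x^(j)(0) t^j / j!]` is in `AC^k([0, T])` for all `T`, i.e. it is `C^(k-1)`
with absolutely continuous `(k - 1)`-st derivative. -/
structure CaputoRegular {n : ℕ} (α : ℂ) (x : ℝ → Fin n → ℂ) : Prop where
  contDiffOn : ContDiffOn ℝ ((caputoIndex α - 1 : ℕ) : ℕ∞) x (Ici 0)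
  contDiffOn_integral :
    ContDiffOn ℝ ((caputoIndex α - 1 : ℕ) : ℕ∞) (caputoIntegral α x) (Ici 0)
  absCont : ∀ T : ℝ, 0 ≤ T → AbsolutelyContinuousOnInterval (caputoPrimitive α x) 0 T

/-- A real vector regarded as a complex one. -/
def toC {n : ℕ} (v : Fin n → ℝ) : Fin n → ℂ := fun i => (v i : ℂ)

/-- A real matrix regarded as a complex one. -/
def matC {n m : ℕ} (M : Matrix (Fin n) (Fin m) ℝ) : Matrix (Fin n) (Fin m) ℂ :=
  M.map Complex.ofReal

/-- A function on `[-h, 0]` that is bounded, continuous outside a null set `N`, and absolutely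
continuous on each compact interval of `[-h, 0]` that does not meet `N`. -/
def AdmissibleInitial {n : ℕ} (h : ℝ) (φ : ℝ → Fin n → ℝ) : Prop :=
  (∃ M : ℝ, ∀ t ∈ Icc (-h) 0, ‖φ t‖ ≤ M) ∧
  ∃ N : Set ℝ, volume N = 0 ∧
    (∀ t ∈ Icc (-h) 0 \ N, ContinuousWithinAt φ (Icc (-h) 0) t) ∧
    ∀ a b : ℝ, a ≤ b → Icc a b ⊆ Icc (-h) 0 \ N → AbsolutelyContinuousOnInterval φ a b

/-- Bounded piecewise continuous functions on `[0, ∞)`: bounded, with finitely many discontinuities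
in each bounded interval, and with finite one-sided limits everywhere. -/
structure BoundedPiecewiseContinuous {m : ℕ} (u : ℝ → Fin m → ℝ) : Prop where
  bounded : ∃ M : ℝ, ∀ t : ℝ, 0 ≤ t → ‖u t‖ ≤ M
  finite_discontinuities :
    ∀ T : ℝ, {t ∈ Icc 0 T | ¬ ContinuousWithinAt u (Ici 0) t}.Finite
  right_limit : ∀ t : ℝ, 0 ≤ t → ∃ r, Tendsto u (𝓝[>] t) (𝓝 r)
  left_limit : ∀ t : ℝ, 0 < t → ∃ l, Tendsto u (𝓝[<] t) (𝓝 l)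

/-- The right-hand side `∑_{i=0}^p A_i x(t - h_i) + B u(t)`. -/
def systemRHS {n m p : ℕ} (A : Fin (p + 1) → Matrix (Fin n) (Fin n) ℝ)
    (B : Matrix (Fin n) (Fin m) ℝ) (d : Fin (p + 1) → ℝ) (u : ℝ → Fin m → ℝ)
    (x : ℝ → Fin n → ℂ) (t : ℝ) : Fin n → ℂ :=
  (∑ i, (matC (A i)).mulVec (x (t - d i))) + (matC B).mulVec (toC (u t))

/-- `x : [-h, ∞) → ℂⁿ`, `h = h_p`, solves the delay system with initial functions `φ_j`, `j < k`, and
control `u`: before time `0` it is the superposition `∑_j φ_j` of the initial functions, at time `0`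
its derivatives of order `j < k` are `φ_j(0)`, and the Caputo equation holds at almost
every `t > 0`. -/
structure IsSolution {n m p : ℕ} (α : ℂ) (A : Fin (p + 1) → Matrix (Fin n) (Fin n) ℝ)
    (B : Matrix (Fin n) (Fin m) ℝ) (d : Fin (p + 1) → ℝ)
    (φ : Fin (caputoIndex α) → ℝ → Fin n → ℝ) (u : ℝ → Fin m → ℝ)
    (x : ℝ → Fin n → ℂ) : Prop where
  history : ∀ t ∈ Ico (-d (Fin.last p)) 0, x t = ∑ j, toC (φ j t)
  regular : CaputoRegular α x
  initial : ∀ j : Fin (caputoIndex α), derivHalfLine (j : ℕ) x 0 = toC (φ j 0)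
  equation : ∀ᵐ t ∂(volume.restrict (Ioi (0 : ℝ))),
    HasCaputoDerivAt α x (systemRHS A B d u x t) t

/-- The `ℓ`-th term `Z^ℓ / Γ(α ℓ + β)` of the matrix Mittag-Leffler series. -/
def mittagLefflerTerm {n : ℕ} (α β : ℂ) (Z : Matrix (Fin n) (Fin n) ℂ) (l : ℕ) :
    Matrix (Fin n) (Fin n) ℂ :=
  (Complex.Gamma (α * l + β))⁻¹ • Z ^ l

/-- The matrix Mittag-Leffler function `E_{α,β}(Z) = ∑_ℓ Z^ℓ / Γ(α ℓ + β)`. -/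
def mittagLeffler {n : ℕ} (α β : ℂ) (Z : Matrix (Fin n) (Fin n) ℂ) : Matrix (Fin n) (Fin n) ℂ :=
  ∑' l : ℕ, mittagLefflerTerm α β Z l

/-- The matrix `A₀ t^α`. -/
def scaledMatrix {n : ℕ} (α : ℂ) (A₀ : Matrix (Fin n) (Fin n) ℝ) (t : ℝ) :
    Matrix (Fin n) (Fin n) ℂ :=
  ((t : ℂ) ^ α) • matC A₀

/-- `Φ_{αj0}(t) = t^j E_{α,j+1}(A₀ t^α)` for `t ≥ 0`, and `0` for `t < 0`. -/
def PhiInit {n : ℕ} (α : ℂ) (A₀ : Matrix (Fin n) (Fin n) ℝ) (j : ℕ) (t : ℝ) :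
    Matrix (Fin n) (Fin n) ℂ :=
  if t < 0 then 0 else ((t : ℂ) ^ j) • mittagLeffler α ((j : ℂ) + 1) (scaledMatrix α A₀ t)

/-- `Φ_α(t) = t^(α-1) E_{α,α}(A₀ t^α)` for `t ≥ 0`, and `0` for `t < 0`. -/
def Phi {n : ℕ} (α : ℂ) (A₀ : Matrix (Fin n) (Fin n) ℝ) (t : ℝ) : Matrix (Fin n) (Fin n) ℂ :=
  if t < 0 then 0 else ((t : ℂ) ^ (α - 1)) • mittagLeffler α α (scaledMatrix α A₀ t)

end CaputoDelay

end

/-! The Caputo problem is equivalent to a Volterra equation: with `f` the right-hand side of the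
system, `x` is a solution exactly when it has the prescribed history and x = ∑ v_j t^j/j! + I^α f on
[0, ∞). The equivalence rests on the semigroup law I^α I^β = I^(α+β), obtained from Fubini and the
Beta integral, and on (I^(β+1) f)' = I^β f. One direction is the namespace `IsVolterra`: I^(k-α) I^α
f = I^k f, whose (k-1)-st derivative is the primitive of `f`. The converse is
`CaputoRegular.isVolterra`, where absolute continuity recovers the primitive from its a.e.
derivative.

Everything analytic about the Volterra equation comes from one estimate, `norm_fracIntegral_le`: in
the norm weighted by exp(-r t), I^β has norm at most `weightBound β r`, which tends to 0 as r → ∞.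
Delays do no harm, since the weight is monotone and the history is fixed. Hence for large r the
integral operator is a contraction, which gives existence (`exists_volterra`) and uniqueness
(`eqOn_zero_of_volterra`) globally on the half-line. Applied to a power function, the same estimate
bounds Γ(z)/Γ(z+α) and yields convergence of the Mittag-Leffler series.

For the representation formula, the delayed terms and the control are treated as a forcing F, and x
= T + I^α(A₀x + F) is iterated. The remainder A₀^N I^(αN) x tends to 0, the series in T sums to the
`PhiInit` terms, and the series in F to the convolution with `Phi` (`variation_of_constants`).
Splitting each delayed integral at h_i separates the history from the solution. For real α, conj x -
x solves the homogeneous equation with zero history, so it vanishes. -/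

noncomputable section

namespace CaputoDelay

/-! ### Locally bounded functions and the Riemann-Liouville integral. -/

section

/-- A function on `(0, ∞)` that is measurable and bounded on bounded intervals. -/
structure LocBdd {E : Type*} [NormedAddCommGroup E] (f : ℝ → E) : Prop where
  aesm : AEStronglyMeasurable f (volume.restrict (Ioi 0))
  bdd : ∀ T : ℝ, ∃ M : ℝ, ∀ t ∈ Ioc 0 T, ‖f t‖ ≤ M

namespace LocBdd

variable {E : Type*} [NormedAddCommGroup E] {f g : ℝ → E}

theorem aesm_Ioc (hf : LocBdd f) (t : ℝ) : AEStronglyMeasurable f (volume.restrict (Ioc 0 t)) :=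
  hf.aesm.mono_measure (Measure.restrict_mono Ioc_subset_Ioi_self le_rfl)

theorem exists_bound (hf : LocBdd f) (T : ℝ) : ∃ M : ℝ, 0 ≤ M ∧ ∀ t ∈ Ioc 0 T, ‖f t‖ ≤ M := by
  obtain ⟨M, hM⟩ := hf.bdd T
  exact ⟨max M 0, le_max_right _ _, fun t ht => (hM t ht).trans (le_max_left _ _)⟩

theorem add (hf : LocBdd f) (hg : LocBdd g) : LocBdd (fun t => f t + g t) where
  aesm := hf.aesm.add hg.aesm
  bdd T := by
    obtain ⟨M, hM⟩ := hf.bdd T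
    obtain ⟨M', hM'⟩ := hg.bdd T
    exact ⟨M + M', fun t ht => (norm_add_le _ _).trans (add_le_add (hM t ht) (hM' t ht))⟩

theorem sum {ι : Type*} (s : Finset ι) {F : ι → ℝ → E} (h : ∀ i ∈ s, LocBdd (F i)) :
    LocBdd (fun t => ∑ i ∈ s, F i t) := by
  classical
  induction s using Finset.induction_on with
  | empty =>
    simp only [Finset.sum_empty]
    exact ⟨aestronglyMeasurable_const, fun T => ⟨0, by simp⟩⟩
  | insert a s ha ih =>
    simp only [Finset.sum_insert ha]
    exact (h a (by simp)).add (ih fun i hi => h i (by simp [hi]))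

theorem clm_comp {F : Type*} [NormedAddCommGroup F] [NormedSpace ℝ E] [NormedSpace ℝ F]
    (L : E →L[ℝ] F) (hf : LocBdd f) : LocBdd (fun t => L (f t)) where
  aesm := L.continuous.comp_aestronglyMeasurable hf.aesm
  bdd T := by
    obtain ⟨M, hM⟩ := hf.bdd T
    exact ⟨‖L‖ * M, fun t ht => (L.le_opNorm _).trans (by gcongr; exact hM t ht)⟩

theorem of_continuousOn (hf : ContinuousOn f (Ici 0)) : LocBdd f where
  aesm := (hf.mono Ioi_subset_Ici_self).aestronglyMeasurable measurableSet_Ioi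
  bdd T := by
    obtain ⟨M, hM⟩ := (isCompact_Icc (a := (0 : ℝ)) (b := T)).exists_bound_of_continuousOn
      (hf.mono fun x hx => hx.1)
    exact ⟨M, fun t ht => hM t ⟨ht.1.le, ht.2⟩⟩

theorem intervalIntegrable [NormedSpace ℝ E] (hf : LocBdd f) {t : ℝ} (ht : 0 ≤ t) :
    IntervalIntegrable f volume 0 t := by
  obtain ⟨M, hM⟩ := hf.bdd t
  rw [intervalIntegrable_iff_integrableOn_Ioc_of_le ht]
  exact Integrable.of_bound (hf.aesm_Ioc t) M
    ((ae_restrict_iff' measurableSet_Ioc).2 (Eventually.of_forall hM))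

end LocBdd

/-- The convolution of an integrable kernel and a bounded measurable function is continuous. -/
theorem continuous_integral_sub_smul {n : ℕ}
    {κ : ℝ → ℂ} {g : ℝ → Fin n → ℂ} (hκ : Integrable κ) (hg : AEStronglyMeasurable g volume) {M : ℝ}
    (hM : ∀ s, ‖g s‖ ≤ M) : Continuous fun t => ∫ s, κ (t - s) • g s := by
  have hM0 : 0 ≤ M := (norm_nonneg _).trans (hM 0)
  have hint : ∀ {κ' : ℝ → ℂ}, Integrable κ' → ∀ t, Integrable fun s => κ' (t - s) • g s := by
    intro κ' h t
    exact (h.comp_sub_left t).smul_bdd M hg (Eventually.of_forall hM)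
  refine continuous_of_uniform_approx_of_continuous fun U hU => ?_
  obtain ⟨ε, hε, hεU⟩ := Metric.mem_uniformity_dist.1 hU
  -- Continuous compactly supported kernels are dense in L¹, and replacing κ by κ' moves the
  -- convolution by at most M‖κ - κ'‖₁, uniformly in t. The `M + 1` keeps the denominator positive
  -- when M = 0.
  obtain ⟨κ', hc, hle, hcont, hint'⟩ := hκ.exists_hasCompactSupport_integral_sub_le
    (show 0 < ε / (2 * (M + 1)) by positivity)
  refine ⟨fun t => ∫ s, κ' (t - s) • g s, ?_, fun t => hεU ?_⟩
  · have hloc : LocallyIntegrable g volume := by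
      rw [locallyIntegrable_iff]
      intro K hK
      exact Measure.integrableOn_of_bounded (M := M) hK.measure_lt_top.ne hg
        (Eventually.of_forall hM)
    exact hc.continuous_convolution_right
      (ContinuousLinearMap.lsmul ℝ ℂ : ℂ →L[ℝ] (Fin n → ℂ) →L[ℝ] Fin n → ℂ).flip
      hloc hcont
  · rw [dist_eq_norm, ← integral_sub (hint hκ t) (hint hint' t)]
    calc ‖∫ s, (κ (t - s) • g s - κ' (t - s) • g s)‖
        ≤ ∫ s, ‖κ (t - s) - κ' (t - s)‖ * M := by
          refine norm_integral_le_of_norm_le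
            (((hκ.sub hint').comp_sub_left t).norm.mul_const M) (Eventually.of_forall fun s => ?_)
          rw [← sub_smul, norm_smul]
          gcongr
          exact hM s
      _ = (∫ s, ‖κ s - κ' s‖) * M := by
          rw [integral_mul_const, integral_sub_left_eq_self (fun s => ‖κ s - κ' s‖)]
      _ ≤ ε / (2 * (M + 1)) * M := by gcongr
      _ < ε := by
          rw [div_mul_eq_mul_div, div_lt_iff₀ (by positivity)]
          nlinarith

variable {n : ℕ} {β : ℂ} {f g : ℝ → Fin n → ℂ}

theorem ne_zero_of_re_pos (hβ : 0 < β.re) : β ≠ 0 := by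
  rintro rfl
  simp at hβ

theorem fracIntegral_zero_order (f : ℝ → Fin n → ℂ) : fracIntegral 0 f = f := by
  ext t
  simp [fracIntegral]

theorem fracIntegral_eq (hβ : 0 < β.re) (f : ℝ → Fin n → ℂ) (t : ℝ) : fracIntegral β f t =
    (Complex.Gamma β)⁻¹ • ∫ τ in (0 : ℝ)..t, (((t - τ : ℝ) : ℂ) ^ (β - 1)) • f τ :=
  if_neg (ne_zero_of_re_pos hβ)

theorem fracIntegral_at_zero (hβ : 0 < β.re) (f : ℝ → Fin n → ℂ) : fracIntegral β f 0 = 0 := by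
  simp [fracIntegral_eq hβ]

theorem intervalIntegrable_kernel (hβ : 0 < β.re) (t : ℝ) :
    IntervalIntegrable (fun τ : ℝ => ((t - τ : ℝ) : ℂ) ^ (β - 1)) volume 0 t := by
  have := (intervalIntegral.intervalIntegrable_cpow' (a := t) (b := 0) (r := β - 1)
    (by simpa using hβ)).comp_sub_left t
  simpa using this

theorem LocBdd.intervalIntegrable_kernel_smul (hβ : 0 < β.re) (hf : LocBdd f) {t : ℝ}
    (ht : 0 ≤ t) :
    IntervalIntegrable (fun τ : ℝ => (((t - τ : ℝ) : ℂ) ^ (β - 1)) • f τ) volume 0 t := by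
  have h := intervalIntegrable_kernel hβ t
  obtain ⟨M, hM⟩ := hf.bdd t
  rw [intervalIntegrable_iff_integrableOn_Ioc_of_le ht] at h ⊢
  exact Integrable.smul_bdd h M (hf.aesm_Ioc t)
    ((ae_restrict_iff' measurableSet_Ioc).2 (Eventually.of_forall hM))

theorem fracIntegral_congr {t : ℝ} (ht : 0 ≤ t) (h : EqOn f g (Icc 0 t)) :
    fracIntegral β f t = fracIntegral β g t := by
  unfold fracIntegral
  rw [h ⟨ht, le_rfl⟩]
  congr 2
  refine intervalIntegral.integral_congr fun s hs => ?_
  rw [uIcc_of_le ht] at hs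
  simp [h hs]

theorem fracIntegral_eqOn (h : EqOn f g (Ici 0)) :
    EqOn (fracIntegral β f) (fracIntegral β g) (Ici 0) :=
  fun _ ht => fracIntegral_congr ht (h.mono fun _ hs => hs.1)

theorem fracIntegral_add (hβ : β = 0 ∨ 0 < β.re) (hf : LocBdd f) (hg : LocBdd g) {t : ℝ}
    (ht : 0 ≤ t) :
    fracIntegral β (fun s => f s + g s) t = fracIntegral β f t + fracIntegral β g t := by
  rcases hβ with rfl | hβ
  · simp [fracIntegral_zero_order]
  · simp only [fracIntegral_eq hβ, smul_add]
    rw [intervalIntegral.integral_add (hf.intervalIntegrable_kernel_smul hβ ht)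
      (hg.intervalIntegrable_kernel_smul hβ ht), smul_add]

theorem fracIntegral_sub (hβ : β = 0 ∨ 0 < β.re) (hf : LocBdd f) (hg : LocBdd g) {t : ℝ}
    (ht : 0 ≤ t) :
    fracIntegral β (fun s => f s - g s) t = fracIntegral β f t - fracIntegral β g t := by
  rcases hβ with rfl | hβ
  · simp [fracIntegral_zero_order]
  · simp only [fracIntegral_eq hβ, smul_sub]
    rw [intervalIntegral.integral_sub (hf.intervalIntegrable_kernel_smul hβ ht)
      (hg.intervalIntegrable_kernel_smul hβ ht), smul_sub]

theorem fracIntegral_clm (hβ : β = 0 ∨ 0 < β.re) (L : (Fin n → ℂ) →L[ℂ] (Fin n → ℂ))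
    (hf : LocBdd f) {t : ℝ} (ht : 0 ≤ t) :
    fracIntegral β (fun s => L (f s)) t = L (fracIntegral β f t) := by
  rcases hβ with rfl | hβ
  · simp [fracIntegral_zero_order]
  · simp only [fracIntegral_eq hβ, map_smul]
    rw [← L.intervalIntegral_comp_comm (hf.intervalIntegrable_kernel_smul hβ ht)]
    simp

/-- The power kernel `s ^ (β - 1)` truncated to `(0, T)`. -/
def truncKernel (β : ℂ) (T : ℝ) : ℝ → ℂ := (Ioo 0 T).indicator fun s => (s : ℂ) ^ (β - 1)

theorem truncKernel_of_mem {T s : ℝ} (hs : s ∈ Ioo 0 T) :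
    truncKernel β T s = (s : ℂ) ^ (β - 1) := indicator_of_mem hs _

theorem truncKernel_of_notMem {T s : ℝ} (hs : s ∉ Ioo 0 T) : truncKernel β T s = 0 :=
  indicator_of_notMem hs _

theorem integrable_truncKernel (hβ : 0 < β.re) {T : ℝ} (hT : 0 ≤ T) :
    Integrable (truncKernel β T) := by
  rw [truncKernel, integrable_indicator_iff measurableSet_Ioo]
  have := intervalIntegral.intervalIntegrable_cpow' (a := 0) (b := T) (r := β - 1)
    (by simpa using hβ)
  rw [intervalIntegrable_iff_integrableOn_Ioc_of_le hT] at this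
  exact this.mono_set Ioo_subset_Ioc_self

/-- Passage from an integral with moving endpoint to a convolution on the whole line, where L¹ and
Fubini arguments apply: the truncated kernel vanishes for τ ≥ r, the truncated function for τ ≤ 0.
-/
theorem integral_truncKernel_smul (f : ℝ → Fin n → ℂ) {r T : ℝ} (hr : 0 ≤ r) (hrT : r ≤ T) :
    ∫ τ, truncKernel β T (r - τ) • (Ioo 0 T).indicator f τ =
      ∫ τ in (0 : ℝ)..r, (((r - τ : ℝ) : ℂ) ^ (β - 1)) • f τ := by
  rw [intervalIntegral.integral_of_le hr, integral_Ioc_eq_integral_Ioo,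
    ← integral_indicator measurableSet_Ioo]
  refine integral_congr_ae (Eventually.of_forall fun τ => ?_)
  by_cases hτ : τ ∈ Ioo 0 r
  · have h1 : r - τ ∈ Ioo 0 T := ⟨by linarith [hτ.2], by linarith [hτ.1]⟩
    have h2 : τ ∈ Ioo 0 T := ⟨hτ.1, by linarith [hτ.2]⟩
    simp only [truncKernel_of_mem h1, indicator_of_mem hτ, indicator_of_mem h2]
  · simp only [indicator_of_notMem hτ]
    by_cases h2 : 0 < τ
    · rw [truncKernel_of_notMem fun h => hτ ⟨h2, by linarith [h.1]⟩, zero_smul]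
    · rw [indicator_of_notMem fun h => h2 h.1, smul_zero]

theorem LocBdd.aesm_indicator (hf : LocBdd f) (T : ℝ) :
    AEStronglyMeasurable ((Ioo 0 T).indicator f) volume :=
  (aestronglyMeasurable_indicator_iff measurableSet_Ioo).2
    (hf.aesm.mono_measure (Measure.restrict_mono Ioo_subset_Ioi_self le_rfl))

theorem LocBdd.exists_bound_indicator (hf : LocBdd f) (T : ℝ) :
    ∃ M, ∀ s, ‖(Ioo 0 T).indicator f s‖ ≤ M := by
  obtain ⟨M, hM0, hM⟩ := hf.exists_bound T
  refine ⟨M, fun s => ?_⟩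
  by_cases hs : s ∈ Ioo 0 T
  · simpa [hs] using hM s ⟨hs.1, hs.2.le⟩
  · simpa [hs] using hM0

/-- The kernel may be singular at 0 but is integrable, so truncating at t + 1 exhibits the integral
near t as an L¹ kernel convolved with a bounded function. -/
theorem continuousOn_fracIntegral (hβ : 0 < β.re) (hf : LocBdd f) :
    ContinuousOn (fracIntegral β f) (Ici 0) := by
  intro t ht
  have hT : 0 ≤ t + 1 := by linarith [mem_Ici.1 ht]
  obtain ⟨M, hM⟩ := hf.exists_bound_indicator (t + 1)
  have hc := continuous_integral_sub_smul (integrable_truncKernel hβ hT)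
    (hf.aesm_indicator (t + 1)) hM
  have hc' : Continuous fun s => (Complex.Gamma β)⁻¹ •
      ∫ τ, truncKernel β (t + 1) (s - τ) • (Ioo 0 (t + 1)).indicator f τ :=
    hc.const_smul (Complex.Gamma β)⁻¹
  refine hc'.continuousWithinAt.congr_of_eventuallyEq_of_mem ?_ ht
  have hnear : Iio (t + 1) ∈ 𝓝[Ici 0] t :=
    mem_nhdsWithin_of_mem_nhds (Iio_mem_nhds (by linarith))
  filter_upwards [hnear, self_mem_nhdsWithin] with s hs hs0
  rw [fracIntegral_eq hβ, integral_truncKernel_smul f hs0 (mem_Iio.1 hs).le]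

theorem LocBdd.fracIntegral (hβ : β = 0 ∨ 0 < β.re) (hf : LocBdd f) :
    LocBdd (fracIntegral β f) := by
  rcases hβ with rfl | hβ
  · rwa [fracIntegral_zero_order]
  · exact .of_continuousOn (continuousOn_fracIntegral hβ hf)

end

/-! ### Semigroup law, differentiation and the exponentially weighted bound. -/

section

variable {n : ℕ} {α β : ℂ} {f g : ℝ → Fin n → ℂ}

/-- Fubini in the variables x = t - τ, y = t - s: the inner integral over y is a scaled Beta
integral. Integrability on the product holds because two L¹ kernels have an integrable convolution
integrand, and the remaining factor is bounded. -/
theorem integral_kernel_kernel (hα : 0 < α.re) (hβ : 0 < β.re) (hf : LocBdd f) {t : ℝ}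
    (ht : 0 < t) :
    ∫ s in (0 : ℝ)..t, (((t - s : ℝ) : ℂ) ^ (α - 1)) •
        ∫ τ in (0 : ℝ)..s, (((s - τ : ℝ) : ℂ) ^ (β - 1)) • f τ =
      Complex.betaIntegral α β • ∫ τ in (0 : ℝ)..t, (((t - τ : ℝ) : ℂ) ^ (α + β - 1)) • f τ := by
  set F := (Ioo 0 t).indicator f with hF
  obtain ⟨M, hM⟩ := hf.exists_bound_indicator t
  have hG : AEStronglyMeasurable (fun x => F (t - x)) volume :=
    (hf.aesm_indicator t).comp_measurePreserving (Measure.measurePreserving_sub_left volume t)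
  set H : ℝ → ℝ → Fin n → ℂ :=
    fun x y => (truncKernel α t y * truncKernel β t (x - y)) • F (t - x) with hH
  have hint : Integrable (Function.uncurry H) (volume.prod volume) := by
    have h1 := (integrable_truncKernel hα ht.le).convolution_integrand
      (ContinuousLinearMap.mul ℝ ℂ) (integrable_truncKernel hβ ht.le)
    exact h1.smul_bdd M (hG.comp_fst) (Eventually.of_forall fun p => hM _)
  have hswap := integral_integral_swap hint
  have hinner : ∀ x ∈ Ioo 0 t, ∫ y, truncKernel α t y * truncKernel β t (x - y) =
      Complex.betaIntegral α β * (x : ℂ) ^ (α + β - 1) := by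
    intro x hx
    rw [mul_comm, ← Complex.betaIntegral_scaled α β hx.1, intervalIntegral.integral_of_le hx.1.le,
      integral_Ioc_eq_integral_Ioo, ← integral_indicator measurableSet_Ioo]
    refine integral_congr_ae (Eventually.of_forall fun y => ?_)
    by_cases hy : y ∈ Ioo 0 x
    · have h1 : y ∈ Ioo 0 t := ⟨hy.1, hy.2.trans hx.2⟩
      have h2 : x - y ∈ Ioo 0 t := ⟨by linarith [hy.2], by linarith [hy.1, hx.2]⟩
      simp only [truncKernel_of_mem h1, truncKernel_of_mem h2, indicator_of_mem hy]
      push_cast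
      rfl
    · simp only [indicator_of_notMem hy]
      by_cases h2 : 0 < y
      · rw [truncKernel_of_notMem (s := x - y) fun h => hy ⟨h2, by linarith [h.1]⟩, mul_zero]
      · rw [truncKernel_of_notMem fun h => h2 h.1, zero_mul]
  have hR : ∫ x, ∫ y, H x y = Complex.betaIntegral α β •
      ∫ τ in (0 : ℝ)..t, (((t - τ : ℝ) : ℂ) ^ (α + β - 1)) • f τ := by
    rw [← integral_truncKernel_smul f ht.le le_rfl, ← integral_smul,
      ← integral_sub_left_eq_self _ volume t]
    refine integral_congr_ae (Eventually.of_forall fun τ => ?_)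
    simp only [hH, sub_sub_cancel]
    rw [integral_smul_const]
    by_cases hτ : τ ∈ Ioo 0 t
    · have h1 : t - τ ∈ Ioo 0 t := ⟨by linarith [hτ.2], by linarith [hτ.1]⟩
      rw [hinner _ h1, truncKernel_of_mem h1, mul_smul]
    · simp [hF, hτ]
  have hL : ∫ y, ∫ x, H x y = ∫ s in (0 : ℝ)..t, (((t - s : ℝ) : ℂ) ^ (α - 1)) •
        ∫ τ in (0 : ℝ)..s, (((s - τ : ℝ) : ℂ) ^ (β - 1)) • f τ := by
    rw [← integral_truncKernel_smul _ ht.le le_rfl,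
      ← integral_sub_left_eq_self _ volume t]
    refine integral_congr_ae (Eventually.of_forall fun s => ?_)
    simp only [hH, mul_smul]
    rw [integral_smul]
    by_cases hs : s ∈ Ioo 0 t
    · rw [indicator_of_mem hs, ← integral_truncKernel_smul f hs.1.le hs.2.le,
        ← integral_sub_left_eq_self _ volume t]
      congr 1
      refine integral_congr_ae (Eventually.of_forall fun τ => ?_)
      simp only [sub_sub_cancel]
      congr 2
      ring
    · rw [truncKernel_of_notMem fun h => hs ⟨by linarith [h.2], by linarith [h.1]⟩, zero_smul,
        zero_smul]
  rw [← hL, ← hR, hswap]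

theorem fracIntegral_fracIntegral_of_pos (hα : 0 < α.re) (hβ : 0 < β.re) (hf : LocBdd f) {t : ℝ}
    (ht : 0 ≤ t) : fracIntegral α (fracIntegral β f) t = fracIntegral (α + β) f t := by
  have hαβ : 0 < (α + β).re := by simpa using add_pos hα hβ
  rcases ht.eq_or_lt with rfl | ht
  · rw [fracIntegral_at_zero hα, fracIntegral_at_zero hαβ]
  · rw [fracIntegral_eq hα, fracIntegral_eq hαβ]
    have : ∀ s : ℝ, (((t - s : ℝ) : ℂ) ^ (α - 1)) • fracIntegral β f s =
        (Complex.Gamma β)⁻¹ • (((t - s : ℝ) : ℂ) ^ (α - 1)) •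
        ∫ τ in (0 : ℝ)..s, (((s - τ : ℝ) : ℂ) ^ (β - 1)) • f τ := by
      intro s
      rw [fracIntegral_eq hβ, smul_comm]
    simp only [this]
    rw [intervalIntegral.integral_smul, integral_kernel_kernel hα hβ hf ht, smul_smul, smul_smul]
    congr 1
    have h := Complex.Gamma_mul_Gamma_eq_betaIntegral hα hβ
    have h1 := Complex.Gamma_ne_zero_of_re_pos hα
    have h2 := Complex.Gamma_ne_zero_of_re_pos hβ
    have h3 := Complex.Gamma_ne_zero_of_re_pos hαβ
    field_simp
    rw [h]
    ring

/-- Order 0 has to be admitted, since k - α = 0 when α is an integer. -/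
theorem fracIntegral_fracIntegral (hα : α = 0 ∨ 0 < α.re) (hβ : β = 0 ∨ 0 < β.re) (hf : LocBdd f)
    {t : ℝ} (ht : 0 ≤ t) : fracIntegral α (fracIntegral β f) t = fracIntegral (α + β) f t := by
  rcases hα with rfl | hα
  · simp [fracIntegral_zero_order]
  rcases hβ with rfl | hβ
  · simp [fracIntegral_zero_order]
  exact fracIntegral_fracIntegral_of_pos hα hβ hf ht

theorem fracIntegral_one (f : ℝ → Fin n → ℂ) (t : ℝ) :
    fracIntegral 1 f t = ∫ τ in (0 : ℝ)..t, f τ := by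
  simp [fracIntegral_eq (β := 1) (by simp)]

theorem hasDerivWithinAt_integral_Ici (hg : ContinuousOn g (Ici 0)) {t : ℝ} (ht : 0 ≤ t) :
    HasDerivWithinAt (fun s => ∫ τ in (0 : ℝ)..s, g τ) (g t) (Ici 0) t := by
  -- Extending by the constant g(0) to the left makes the two-sided fundamental theorem available
  -- also at 0.
  have hc : Continuous fun s => g (max s 0) :=
    hg.comp_continuous (by fun_prop) fun s => mem_Ici.2 (le_max_right _ _)
  have h := (hc.integral_hasStrictDerivAt 0 t).hasDerivAt.hasDerivWithinAt (s := Ici 0)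
  rw [max_eq_left ht] at h
  refine h.congr_of_mem (fun s hs => ?_) ht
  refine intervalIntegral.integral_congr fun τ hτ => ?_
  rw [uIcc_of_le hs] at hτ
  simp [max_eq_left hτ.1]

theorem hasDerivWithinAt_fracIntegral (hβ : β = 0 ∨ 0 < β.re) (hf : LocBdd f)
    (hc : ContinuousOn (fracIntegral β f) (Ici 0)) {t : ℝ} (ht : 0 ≤ t) :
    HasDerivWithinAt (fracIntegral (β + 1) f) (fracIntegral β f t) (Ici 0) t := by
  refine (hasDerivWithinAt_integral_Ici hc ht).congr_of_mem (fun s hs => ?_) ht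
  rw [add_comm, ← fracIntegral_fracIntegral (Or.inr (by simp)) hβ hf hs, fracIntegral_one]

theorem fracIntegral_monomial (hβ : 0 < β.re) (j : ℕ) (v : Fin n → ℂ) {t : ℝ} (ht : 0 ≤ t) :
    fracIntegral β (fun s => ((s : ℂ) ^ j / (j.factorial : ℂ)) • v) t =
      ((t : ℂ) ^ j * (t : ℂ) ^ β * (Complex.Gamma (β + j + 1))⁻¹) • v := by
  rcases ht.eq_or_lt with rfl | ht
  · simp [fracIntegral_at_zero hβ, Complex.zero_cpow (ne_zero_of_re_pos hβ)]
  have hj : 0 < ((j : ℂ) + 1).re := by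
    simp only [Complex.add_re, Complex.natCast_re, Complex.one_re]
    positivity
  have h := Complex.betaIntegral_scaled (j + 1) β ht
  have hG := Complex.Gamma_mul_Gamma_eq_betaIntegral hj hβ
  have h1 := Complex.Gamma_ne_zero_of_re_pos hβ
  have h2 : Complex.Gamma (j + 1 + β) ≠ 0 :=
    Complex.Gamma_ne_zero_of_re_pos (by rw [Complex.add_re]; exact add_pos hj hβ)
  have h3 : (j.factorial : ℂ) ≠ 0 := by exact_mod_cast j.factorial_ne_zero
  have ht' : (t : ℂ) ≠ 0 := by exact_mod_cast ht.ne'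
  rw [fracIntegral_eq hβ]
  have : ∀ τ : ℝ, (((t - τ : ℝ) : ℂ) ^ (β - 1)) • ((τ : ℂ) ^ j / (j.factorial : ℂ)) • v =
      ((τ : ℂ) ^ ((j : ℂ) + 1 - 1) * ((t : ℂ) - τ) ^ (β - 1)) • (j.factorial : ℂ)⁻¹ • v := by
    intro τ
    rw [smul_smul, smul_smul]
    congr 1
    rw [add_sub_cancel_right, Complex.cpow_natCast]
    push_cast
    ring
  simp only [this]
  rw [intervalIntegral.integral_smul_const, h, smul_smul, smul_smul]
  congr 1
  rw [Complex.Gamma_nat_eq_factorial] at hG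
  have e1 : (j : ℂ) + 1 + β - 1 = j + β := by ring
  have e2 : β + j + 1 = j + 1 + β := by ring
  rw [e1, e2, Complex.cpow_add _ _ ht', Complex.cpow_natCast]
  have hB : Complex.betaIntegral (j + 1) β =
      j.factorial * Complex.Gamma β / Complex.Gamma (j + 1 + β) := by
    rw [hG]
    field_simp
  rw [hB]
  field_simp

/-- The bound for the fractional integral of order `β` in the norm with weight `exp (-r t)`. -/
def weightBound (β : ℂ) (r : ℝ) : ℝ := ‖Complex.Gamma β‖⁻¹ * ((1 / r) ^ β.re * Real.Gamma β.re)

theorem weightBound_nonneg (hβ : 0 < β.re) {r : ℝ} (hr : 0 < r) : 0 ≤ weightBound β r := by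
  have := Real.Gamma_pos_of_pos hβ
  unfold weightBound
  positivity

theorem tendsto_weightBound (hβ : 0 < β.re) : Tendsto (weightBound β) atTop (𝓝 0) := by
  have h : Tendsto (fun r : ℝ => (1 / r) ^ β.re) atTop (𝓝 0) := by
    have := (tendsto_rpow_neg_atTop hβ)
    refine this.congr' ?_
    filter_upwards [eventually_gt_atTop 0] with r hr
    rw [one_div, Real.inv_rpow hr.le, Real.rpow_neg hr.le]
  have := (h.mul_const (Real.Gamma β.re)).const_mul ‖Complex.Gamma β‖⁻¹
  rw [zero_mul, mul_zero] at this
  exact this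

/-- Once exp(r t) is pulled out, what remains is a truncated Laplace integral of s^(Re β - 1),
bounded by the full one, r^(-Re β) Γ(Re β). -/
theorem norm_fracIntegral_le (hβ : 0 < β.re) {r M t : ℝ} (hr : 0 < r) (hM : 0 ≤ M) (ht : 0 ≤ t)
    (hf : ∀ s ∈ Ioc 0 t, ‖f s‖ ≤ M * Real.exp (r * s)) :
    ‖fracIntegral β f t‖ ≤ M * weightBound β r * Real.exp (r * t) := by
  have hval := Real.integral_rpow_mul_exp_neg_mul_Ioi hβ hr
  have hpos : 0 < (1 / r) ^ β.re * Real.Gamma β.re :=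
    mul_pos (by positivity) (Real.Gamma_pos_of_pos hβ)
  -- A non-integrable function would have integral 0 by convention, whereas the value is positive.
  have hint : IntegrableOn (fun s : ℝ => s ^ (β.re - 1) * Real.exp (-(r * s))) (Ioi 0) := by
    by_contra h
    rw [integral_undef h] at hval
    exact hpos.ne hval
  have hintt : IntervalIntegrable (fun s : ℝ => s ^ (β.re - 1) * Real.exp (-(r * s))) volume 0 t :=
    (intervalIntegrable_iff_integrableOn_Ioc_of_le ht).2 (hint.mono_set Ioc_subset_Ioi_self)
  rw [fracIntegral_eq hβ, norm_smul, norm_inv]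
  have hmain : ‖∫ τ in (0 : ℝ)..t, (((t - τ : ℝ) : ℂ) ^ (β - 1)) • f τ‖ ≤
      ∫ τ in (0 : ℝ)..t, M * Real.exp (r * t) *
        ((t - τ) ^ (β.re - 1) * Real.exp (-(r * (t - τ)))) := by
    refine intervalIntegral.norm_integral_le_of_norm_le ht ?_ ?_
    · have hne : ∀ᵐ τ : ℝ, τ ≠ t := by simp [ae_iff, measure_singleton]
      filter_upwards [hne] with τ hτt hτ
      have hlt : 0 < t - τ := sub_pos.2 (lt_of_le_of_ne hτ.2 hτt)
      rw [norm_smul, Complex.norm_cpow_eq_rpow_re_of_pos hlt, Complex.sub_re, Complex.one_re]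
      calc (t - τ) ^ (β.re - 1) * ‖f τ‖ ≤ (t - τ) ^ (β.re - 1) * (M * Real.exp (r * τ)) := by
            gcongr
            exact hf τ hτ
        _ = _ := by
            have : Real.exp (r * τ) = Real.exp (r * t) * Real.exp (-(r * (t - τ))) := by
              rw [← Real.exp_add]
              ring_nf
            rw [this]
            ring
    · have := (hintt.symm.comp_sub_left t).const_mul (M * Real.exp (r * t))
      simpa using this
  have heq : ∫ τ in (0 : ℝ)..t, M * Real.exp (r * t) *
        ((t - τ) ^ (β.re - 1) * Real.exp (-(r * (t - τ)))) = M * Real.exp (r * t) *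
        ∫ s in (0 : ℝ)..t, s ^ (β.re - 1) * Real.exp (-(r * s)) := by
    rw [intervalIntegral.integral_const_mul, intervalIntegral.integral_comp_sub_left
      (fun s => s ^ (β.re - 1) * Real.exp (-(r * s))) t]
    simp
  have hle : ∫ s in (0 : ℝ)..t, s ^ (β.re - 1) * Real.exp (-(r * s)) ≤
      (1 / r) ^ β.re * Real.Gamma β.re := by
    rw [← hval, intervalIntegral.integral_of_le ht]
    refine setIntegral_mono_set hint ?_ Ioc_subset_Ioi_self.eventuallyLE
    refine (ae_restrict_iff' measurableSet_Ioi).2 (Eventually.of_forall fun s hs => ?_)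
    have : (0 : ℝ) < s := hs
    simp only [Pi.zero_apply]
    positivity
  calc ‖Complex.Gamma β‖⁻¹ * ‖∫ τ in (0 : ℝ)..t, (((t - τ : ℝ) : ℂ) ^ (β - 1)) • f τ‖
      ≤ ‖Complex.Gamma β‖⁻¹ * (M * Real.exp (r * t) * ((1 / r) ^ β.re * Real.Gamma β.re)) := by
        gcongr
        rw [heq] at hmain
        exact hmain.trans (by gcongr)
    _ = _ := by
        rw [weightBound]
        ring

end

/-! ### From the integral equation to the Caputo equation. -/

section

section Derivatives

variable {E : Type*} [NormedAddCommGroup E] [NormedSpace ℝ E]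

/-- Iterated derivatives are never computed directly: it suffices to exhibit the expected ones as a
chain, such as I^(α-j) f, whose consecutive members are related by one differentiation. -/
theorem iteratedDerivWithin_eqOn_of_chain {F : ℕ → ℝ → E} {m : ℕ}
    (h : ∀ j < m, ∀ t ∈ Ici (0 : ℝ), HasDerivWithinAt (F j) (F (j + 1) t) (Ici 0) t) :
    ∀ j ≤ m, EqOn (iteratedDerivWithin j (F 0) (Ici 0)) (F j) (Ici 0) := by
  intro j
  induction j with
  | zero => intro _ t _; simp
  | succ j ih =>
    intro hj t ht
    rw [iteratedDerivWithin_succ, derivWithin_congr (ih (by omega)) (ih (by omega) ht)]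
    exact (h j (by omega) t ht).derivWithin (uniqueDiffOn_Ici 0 t ht)

theorem contDiffOn_of_chain {F : ℕ → ℝ → E} {m : ℕ}
    (h : ∀ j < m, ∀ t ∈ Ici (0 : ℝ), HasDerivWithinAt (F j) (F (j + 1) t) (Ici 0) t)
    (hc : ContinuousOn (F m) (Ici 0)) : ContDiffOn ℝ ((m : ℕ∞) : WithTop ℕ∞) (F 0) (Ici 0) := by
  have hiter := iteratedDerivWithin_eqOn_of_chain h
  refine contDiffOn_of_continuousOn_differentiableOn_deriv (fun j hj => ?_) fun j hj => ?_
  · have hj' : j ≤ m := by exact_mod_cast hj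
    refine ContinuousOn.congr ?_ (hiter j hj')
    rcases hj'.eq_or_lt with rfl | hlt
    · exact hc
    · exact fun t ht => (h j hlt t ht).continuousWithinAt
  · have hj' : j < m := by exact_mod_cast hj
    exact DifferentiableOn.congr (fun t ht => (h j hj' t ht).differentiableWithinAt)
      (hiter j hj'.le)

theorem hasDerivWithinAt_iteratedDerivWithin {y : ℝ → E} {m : ℕ}
    (hy : ContDiffOn ℝ ((m : ℕ∞) : WithTop ℕ∞) y (Ici 0)) {j : ℕ} (hj : j < m) {t : ℝ}
    (ht : t ∈ Ici (0 : ℝ)) :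
    HasDerivWithinAt (iteratedDerivWithin j y (Ici 0))
      (iteratedDerivWithin (j + 1) y (Ici 0) t) (Ici 0) t := by
  rw [iteratedDerivWithin_succ]
  exact (hy.differentiableOn_iteratedDerivWithin (by exact_mod_cast hj) (uniqueDiffOn_Ici 0) t
    ht).hasDerivWithinAt

end Derivatives

variable {n : ℕ} {α β : ℂ} {f g x y : ℝ → Fin n → ℂ} {m : ℕ} {v : ℕ → Fin n → ℂ}

/-- The polynomial `∑_{i<k} t^i / i! • v (i + j)`. -/
def taylorPoly (v : ℕ → Fin n → ℂ) (k j : ℕ) (t : ℝ) : Fin n → ℂ :=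
  ∑ i ∈ Finset.range k, ((t : ℂ) ^ i / (i.factorial : ℂ)) • v (i + j)

theorem taylorPoly_zero (v : ℕ → Fin n → ℂ) (m j : ℕ) : taylorPoly v (m + 1) j 0 = v j := by
  simp [taylorPoly, Finset.sum_range_succ']

theorem continuous_taylorPoly (v : ℕ → Fin n → ℂ) (k j : ℕ) : Continuous (taylorPoly v k j) := by
  unfold taylorPoly
  fun_prop

theorem hasDerivAt_monomial (i : ℕ) (w : Fin n → ℂ) (t : ℝ) :
    HasDerivAt (fun s : ℝ => ((s : ℂ) ^ (i + 1) / ((i + 1).factorial : ℂ)) • w)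
      (((t : ℂ) ^ i / (i.factorial : ℂ)) • w) t := by
  have h := (((hasDerivAt_id t).ofReal_comp.pow (i + 1)).div_const
    ((i + 1).factorial : ℂ)).smul_const w
  convert! h using 1
  have h1 : (i.factorial : ℂ) ≠ 0 := by exact_mod_cast i.factorial_ne_zero
  have h2 : ((i : ℂ) + 1) ≠ 0 := by exact_mod_cast i.succ_ne_zero
  congr 1
  rw [Nat.factorial_succ]
  push_cast
  simp only [id_eq]
  field_simp

/-- Differentiation shifts the coefficients while the number of summands stays m + 1; the
superfluous top coefficient v(m + j + 1) is zero by `hv`. -/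
theorem hasDerivAt_taylorPoly (hv : ∀ j, m < j → v j = 0) (j : ℕ) (t : ℝ) :
    HasDerivAt (taylorPoly v (m + 1) j) (taylorPoly v (m + 1) (j + 1) t) t := by
  have h1 : taylorPoly v (m + 1) j = fun s : ℝ => (∑ i ∈ Finset.range m,
      ((s : ℂ) ^ (i + 1) / ((i + 1).factorial : ℂ)) • v (i + 1 + j)) + v j := by
    ext1 s
    simp [taylorPoly, Finset.sum_range_succ']
  have h2 : taylorPoly v (m + 1) (j + 1) t = ∑ i ∈ Finset.range m,
      ((t : ℂ) ^ i / (i.factorial : ℂ)) • v (i + 1 + j) := by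
    rw [taylorPoly, Finset.sum_range_succ, hv (m + (j + 1)) (by omega), smul_zero, add_zero]
    exact Finset.sum_congr rfl fun i _ => by rw [add_assoc, add_comm j 1]
  rw [h1, h2]
  exact (HasDerivAt.fun_sum fun i _ => hasDerivAt_monomial i _ t).add_const _

/-- The only facts about k = m + 1 that are needed: Re(α - m) > 0 makes I^(α-j) f continuous and
zero at 0 for all j ≤ m, and k - α is an order for which I is defined. For non-integer α the first
is strict because Re α is not an integer. -/
theorem caputoIndex_spec (hα : AdmissibleOrder α) : ∃ m : ℕ, caputoIndex α = m + 1 ∧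
    0 < (α - m).re ∧ (((m + 1 : ℕ) : ℂ) - α = 0 ∨ 0 < (((m + 1 : ℕ) : ℂ) - α).re) := by
  rcases hα with ⟨k, hk, rfl⟩ | ⟨h0, hne⟩
  · refine ⟨k - 1, ?_, ?_, Or.inl ?_⟩
    · rw [caputoIndex, if_pos ⟨k, rfl⟩]
      simp only [Complex.natCast_re, Nat.floor_natCast]
      omega
    · rw [Nat.cast_sub hk]
      simp
    · rw [Nat.sub_add_cancel hk, sub_self]
  · have hno : ¬ ∃ m : ℕ, α = m := by
      rintro ⟨m, rfl⟩
      exact hne m (by simp)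
    refine ⟨⌊α.re⌋₊, ?_, ?_, Or.inr ?_⟩
    · rw [caputoIndex, if_neg hno]
    · rw [Complex.sub_re, Complex.natCast_re, sub_pos]
      exact lt_of_le_of_ne (Nat.floor_le h0.le) (hne _).symm
    · rw [Complex.sub_re, Complex.natCast_re, sub_pos]
      exact_mod_cast Nat.lt_floor_add_one α.re

theorem AdmissibleOrder.re_pos (hα : AdmissibleOrder α) : 0 < α.re := by
  rcases hα with ⟨k, hk, rfl⟩ | ⟨h0, -⟩
  · simpa using hk
  · exact h0

theorem re_sub_natCast_pos (hm : 0 < (α - m).re) {j : ℕ} (hj : j ≤ m) : 0 < (α - j).re := by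
  have : (j : ℝ) ≤ m := by exact_mod_cast hj
  simp only [Complex.sub_re, Complex.natCast_re] at hm ⊢
  linarith

/-- A function of the form polynomial plus `I^β f` is differentiated term by term. -/
theorem hasDerivWithinAt_taylorPoly_add_fracIntegral (hf : LocBdd f) (hv : ∀ j, m < j → v j = 0)
    (hm : 0 < (α - m).re) {j : ℕ} (hj : j < m) {t : ℝ} (ht : t ∈ Ici (0 : ℝ)) :
    HasDerivWithinAt (fun s => taylorPoly v (m + 1) j s + fracIntegral (α - j) f s)
      (taylorPoly v (m + 1) (j + 1) t + fracIntegral (α - (j + 1 : ℕ)) f t) (Ici 0) t := by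
  have hpos := re_sub_natCast_pos hm (show j + 1 ≤ m from hj)
  have h := hasDerivWithinAt_fracIntegral (Or.inr hpos) hf (continuousOn_fracIntegral hpos hf) ht
  have e : α - (j + 1 : ℕ) + 1 = α - j := by
    push_cast
    ring
  rw [e] at h
  exact (hasDerivAt_taylorPoly hv j t).hasDerivWithinAt.add h

/-- `x` solves on `[0, ∞)` the integral equation `x = ∑_j v_j t^j / j! + I^α f`, where
`m + 1` is the integer of the order `α`, `f` is measurable and locally bounded, and `v j = 0` for
`j > m`. -/
structure IsVolterra (α : ℂ) (m : ℕ) (v : ℕ → Fin n → ℂ) (f x : ℝ → Fin n → ℂ) : Prop where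
  index : caputoIndex α = m + 1
  re_pos : 0 < (α - m).re
  gap : ((m + 1 : ℕ) : ℂ) - α = 0 ∨ 0 < (((m + 1 : ℕ) : ℂ) - α).re
  locBdd : LocBdd f
  coeff : ∀ j, m < j → v j = 0
  eq : ∀ t ∈ Ici (0 : ℝ), x t = taylorPoly v (m + 1) 0 t + fracIntegral α f t

/-- The integrand is bounded on (0, T], so its primitive is Lipschitz there. -/
theorem LocBdd.absolutelyContinuous_of_eqOn_integral (hf : LocBdd f)
    (h : EqOn g (fun t => ∫ τ in (0 : ℝ)..t, f τ) (Ici 0)) {T : ℝ} (hT : 0 ≤ T) :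
    AbsolutelyContinuousOnInterval g 0 T := by
  obtain ⟨M, hM0, hM⟩ := hf.exists_bound T
  lift M to NNReal using hM0
  refine LipschitzOnWith.absolutelyContinuousOnInterval (K := M) ?_
  rw [uIcc_of_le hT]
  refine lipschitzOnWith_iff_norm_sub_le.2 fun s hs t ht => ?_
  rw [h hs.1, h ht.1]
  simp only
  rw [intervalIntegral.integral_interval_sub_left (hf.intervalIntegrable hs.1)
    (hf.intervalIntegrable ht.1)]
  refine intervalIntegral.norm_integral_le_of_norm_le_const fun τ hτ => hM τ ⟨?_, ?_⟩
  · exact (le_min ht.1 hs.1).trans_lt hτ.1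
  · exact hτ.2.trans (max_le ht.2 hs.2)

theorem LocBdd.ae_hasDerivAt_integral (hf : LocBdd f) :
    ∀ᵐ t ∂(volume.restrict (Ioi (0 : ℝ))),
      HasDerivAt (fun t => ∫ τ in (0 : ℝ)..t, f τ) (f t) t := by
  rw [ae_restrict_iff' measurableSet_Ioi]
  have h : ∀ᵐ t : ℝ, ∀ N : ℕ, t ∈ uIcc (0 : ℝ) N → ∀ c ∈ uIcc (0 : ℝ) N,
      HasDerivAt (fun x => ∫ (t : ℝ) in c..x, f t) (f t) t :=
    ae_all_iff.2 fun N => (hf.intervalIntegrable (Nat.cast_nonneg N)).ae_hasDerivAt_integral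
  filter_upwards [h] with t ht ht0
  obtain ⟨N, hN⟩ := exists_nat_ge t
  refine ht N ?_ 0 left_mem_uIcc
  rw [uIcc_of_le (Nat.cast_nonneg N)]
  exact ⟨le_of_lt ht0, hN⟩

namespace IsVolterra

theorem contDiffOn (H : IsVolterra α m v f x) : ContDiffOn ℝ ((m : ℕ∞) : WithTop ℕ∞) x (Ici 0) := by
  have h := contDiffOn_of_chain
    (F := fun j s => taylorPoly v (m + 1) j s + fracIntegral (α - j) f s) (m := m)
    (fun j hj t ht => hasDerivWithinAt_taylorPoly_add_fracIntegral H.locBdd H.coeff H.re_pos hj ht)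
    ((continuous_taylorPoly v _ _).continuousOn.add (continuousOn_fracIntegral H.re_pos H.locBdd))
  exact h.congr fun t ht => by simpa using H.eq t ht

theorem derivHalfLine_eq (H : IsVolterra α m v f x) {j : ℕ} (hj : j ≤ m) :
    derivHalfLine j x 0 = v j := by
  have h := iteratedDerivWithin_eqOn_of_chain
    (F := fun j s => taylorPoly v (m + 1) j s + fracIntegral (α - j) f s) (m := m)
    (fun j hj t ht =>
      hasDerivWithinAt_taylorPoly_add_fracIntegral H.locBdd H.coeff H.re_pos hj ht) j hj
  have h0 : (0 : ℝ) ∈ Ici (0 : ℝ) := mem_Ici.2 le_rfl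
  rw [derivHalfLine, iteratedDerivWithin_congr (g := fun s => taylorPoly v (m + 1) 0 s +
    fracIntegral (α - (0 : ℕ)) f s) (fun t ht => by simpa using H.eq t ht) h0, h h0]
  simp only
  rw [taylorPoly_zero, fracIntegral_at_zero (re_sub_natCast_pos H.re_pos hj), add_zero]

theorem taylorPart_eq (H : IsVolterra α m v f x) (t : ℝ) :
    taylorPart (m + 1) x t = taylorPoly v (m + 1) 0 t := by
  refine Finset.sum_congr rfl fun j hj => ?_
  rw [H.derivHalfLine_eq (by simpa [Nat.lt_succ_iff] using hj), add_zero]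

/-- The Taylor part of `x` is exactly the polynomial of the equation, so I^(k-α) acts on I^α f alone
and the semigroup law gives an integral of integer order. -/
theorem caputoIntegral_eqOn (H : IsVolterra α m v f x) :
    EqOn (caputoIntegral α x) (fracIntegral ((m + 1 : ℕ) : ℂ) f) (Ici 0) := by
  intro t ht
  have hα : 0 < α.re := by simpa using re_sub_natCast_pos H.re_pos (Nat.zero_le m)
  rw [caputoIntegral, H.index]
  have : EqOn (fun τ => x τ - taylorPart (m + 1) x τ) (fracIntegral α f) (Ici 0) := by
    intro s hs
    simp only
    rw [H.taylorPart_eq, H.eq s hs, add_sub_cancel_left]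
  rw [fracIntegral_eqOn this ht, fracIntegral_fracIntegral H.gap (Or.inr hα) H.locBdd ht,
    sub_add_cancel]

theorem contDiffOn_caputoIntegral_and_caputoPrimitive (H : IsVolterra α m v f x) :
    ContDiffOn ℝ ((m : ℕ∞) : WithTop ℕ∞) (caputoIntegral α x) (Ici 0) ∧
      EqOn (caputoPrimitive α x) (fun t => ∫ τ in (0 : ℝ)..t, f τ) (Ici 0) := by
  have hG := H.caputoIntegral_eqOn
  have hpos : ∀ j ≤ m, 0 < (((m + 1 : ℕ) : ℂ) - j).re := by
    intro j hj
    refine re_sub_natCast_pos (m := m) ?_ hj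
    simp
  have hchain : ∀ j < m, ∀ t ∈ Ici (0 : ℝ),
      HasDerivWithinAt (fracIntegral (((m + 1 : ℕ) : ℂ) - j) f)
        (fracIntegral (((m + 1 : ℕ) : ℂ) - (j + 1 : ℕ)) f t) (Ici 0) t := by
    intro j hj t ht
    have hp := hpos (j + 1) hj
    have h := hasDerivWithinAt_fracIntegral (Or.inr hp) H.locBdd
      (continuousOn_fracIntegral hp H.locBdd) ht
    have e : ((m + 1 : ℕ) : ℂ) - (j + 1 : ℕ) + 1 = ((m + 1 : ℕ) : ℂ) - j := by
      push_cast
      ring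
    rwa [e] at h
  have hG' : EqOn (caputoIntegral α x) (fracIntegral (((m + 1 : ℕ) : ℂ) - (0 : ℕ)) f) (Ici 0) := by
    simpa using hG
  refine ⟨(contDiffOn_of_chain (F := fun j => fracIntegral (((m + 1 : ℕ) : ℂ) - j) f) hchain
    (continuousOn_fracIntegral (hpos m le_rfl) H.locBdd)).congr hG', fun t ht => ?_⟩
  rw [caputoPrimitive, H.index, Nat.add_sub_cancel, derivHalfLine, iteratedDerivWithin_congr hG' ht,
    iteratedDerivWithin_eqOn_of_chain (F := fun j => fracIntegral (((m + 1 : ℕ) : ℂ) - j) f)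
      hchain m le_rfl ht]
  have e : ((m + 1 : ℕ) : ℂ) - m = 1 := by
    push_cast
    ring
  rw [e, fracIntegral_one]

theorem caputoPrimitive_eqOn (H : IsVolterra α m v f x) :
    EqOn (caputoPrimitive α x) (fun t => ∫ τ in (0 : ℝ)..t, f τ) (Ici 0) :=
  H.contDiffOn_caputoIntegral_and_caputoPrimitive.2

theorem caputoRegular (H : IsVolterra α m v f x) : CaputoRegular α x where
  contDiffOn := by
    rw [H.index, Nat.add_sub_cancel]
    exact H.contDiffOn
  contDiffOn_integral := by
    rw [H.index, Nat.add_sub_cancel]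
    exact H.contDiffOn_caputoIntegral_and_caputoPrimitive.1
  absCont _ hT :=
    H.locBdd.absolutelyContinuous_of_eqOn_integral H.caputoPrimitive_eqOn hT

theorem hasCaputoDerivAt_of_hasDerivAt_integral (H : IsVolterra α m v f x) {t : ℝ} (ht : 0 < t)
    {w : Fin n → ℂ}
    (h : HasDerivAt (fun t => ∫ τ in (0 : ℝ)..t, f τ) w t) : HasCaputoDerivAt α x w t := by
  refine h.congr_of_eventuallyEq ?_
  filter_upwards [Ioi_mem_nhds ht] with s hs
  exact H.caputoPrimitive_eqOn (mem_Ici.2 (le_of_lt hs))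

theorem hasCaputoDerivAt (H : IsVolterra α m v f x) {t : ℝ} (ht : 0 < t) (hc : ContinuousAt f t) :
    HasCaputoDerivAt α x (f t) t := by
  refine H.hasCaputoDerivAt_of_hasDerivAt_integral ht
    (intervalIntegral.integral_hasDerivAt_right (H.locBdd.intervalIntegrable ht.le) ?_ hc)
  exact ⟨Ioi 0, Ioi_mem_nhds ht, H.locBdd.aesm⟩

theorem ae_hasCaputoDerivAt (H : IsVolterra α m v f x) :
    ∀ᵐ t ∂(volume.restrict (Ioi (0 : ℝ))), HasCaputoDerivAt α x (f t) t := by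
  filter_upwards [H.locBdd.ae_hasDerivAt_integral, ae_restrict_mem measurableSet_Ioi] with t ht ht0
  exact H.hasCaputoDerivAt_of_hasDerivAt_integral ht0 ht

end IsVolterra

end

/-! ### From the Caputo equation back to the integral equation. -/

section

variable {n : ℕ} {α β : ℂ} {f g x y : ℝ → Fin n → ℂ} {m : ℕ} {v : ℕ → Fin n → ℂ}

theorem eq_integral_of_hasDerivWithinAt {g g' : ℝ → Fin n → ℂ}
    (h : ∀ t ∈ Ici (0 : ℝ), HasDerivWithinAt g (g' t) (Ici 0) t)
    (hc : ContinuousOn g' (Ici 0)) (h0 : g 0 = 0) {t : ℝ} (ht : 0 ≤ t) :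
    g t = ∫ τ in (0 : ℝ)..t, g' τ := by
  rw [intervalIntegral.integral_eq_sub_of_hasDerivAt_of_le ht (f := g), h0, sub_zero]
  · exact fun s hs => (h s hs.1).continuousWithinAt.mono fun r hr => hr.1
  · exact fun s hs => (h s hs.1.le).hasDerivAt (Ici_mem_nhds hs.1)
  · exact (LocBdd.of_continuousOn hc).intervalIntegrable ht

/-- Taylor's formula with integral remainder for a function all of whose derivatives of order
`< m` vanish at `0`. -/
theorem eq_fracIntegral_of_chain {F : ℕ → ℝ → Fin n → ℂ} {m : ℕ}
    (h : ∀ j < m, ∀ t ∈ Ici (0 : ℝ), HasDerivWithinAt (F j) (F (j + 1) t) (Ici 0) t)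
    (hc : ∀ j ≤ m, ContinuousOn (F j) (Ici 0)) (h0 : ∀ j < m, F j 0 = 0) :
    EqOn (F 0) (fracIntegral (m : ℂ) (F m)) (Ici 0) := by
  induction m with
  | zero =>
    intro t _
    rw [Nat.cast_zero, fracIntegral_zero_order]
  | succ m ih =>
    intro t ht
    rw [ih (fun j hj => h j (by omega)) (fun j hj => hc j (by omega)) (fun j hj => h0 j (by omega))
      ht]
    have e : EqOn (F m) (fracIntegral 1 (F (m + 1))) (Ici 0) := by
      intro s hs
      rw [fracIntegral_one]
      exact eq_integral_of_hasDerivWithinAt (h m (by omega)) (hc (m + 1) le_rfl)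
        (h0 m (by omega)) hs
    have hm : (m : ℂ) = 0 ∨ 0 < (m : ℂ).re := by
      rcases m.eq_zero_or_pos with rfl | hm
      · left; simp
      · right; simpa using hm
    rw [fracIntegral_eqOn e ht, fracIntegral_fracIntegral hm (Or.inr (by simp))
      (.of_continuousOn (hc (m + 1) le_rfl)) ht]
    push_cast
    rfl

theorem iteratedDerivWithin_fracIntegral_natCast {H : ℝ → Fin n → ℂ}
    (hH : ContinuousOn H (Ici 0)) (m : ℕ) :
    EqOn (iteratedDerivWithin m (fracIntegral (m : ℂ) H) (Ici 0)) H (Ici 0) := by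
  have hL := LocBdd.of_continuousOn hH
  have hcast : ∀ i : ℕ, ((i : ℂ) = 0 ∨ 0 < (i : ℂ).re) ∧
      ContinuousOn (fracIntegral (i : ℂ) H) (Ici 0) := by
    intro i
    rcases i.eq_zero_or_pos with rfl | hi
    · rw [Nat.cast_zero, fracIntegral_zero_order]
      exact ⟨Or.inl rfl, hH⟩
    · have : 0 < (i : ℂ).re := by simpa using hi
      exact ⟨Or.inr this, continuousOn_fracIntegral this hL⟩
  -- The subtraction is taken in ℕ before the cast, so that the last member of the chain has order
  -- literally 0 and is `H` itself.
  have hchain : ∀ j < m, ∀ t ∈ Ici (0 : ℝ),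
      HasDerivWithinAt (fracIntegral ((m - j : ℕ) : ℂ) H)
        (fracIntegral ((m - (j + 1) : ℕ) : ℂ) H t) (Ici 0) t := by
    intro j hj t ht
    obtain ⟨hi, hic⟩ := hcast (m - (j + 1))
    have h := hasDerivWithinAt_fracIntegral hi hL hic ht
    have e : ((m - (j + 1) : ℕ) : ℂ) + 1 = ((m - j : ℕ) : ℂ) := by
      rw [show m - j = m - (j + 1) + 1 by omega]
      push_cast
      rfl
    rwa [e] at h
  intro t ht
  have h := iteratedDerivWithin_eqOn_of_chain
    (F := fun j => fracIntegral ((m - j : ℕ) : ℂ) H) hchain m le_rfl ht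
  simp only [Nat.sub_zero, Nat.sub_self, Nat.cast_zero, fracIntegral_zero_order] at h
  exact h

/-- The difference of the two sides is absolutely continuous with derivative zero a.e., hence
constant; without absolute continuity a Cantor-type function would be a counterexample. -/
theorem eqOn_integral_of_absolutelyContinuous {H : ℝ → Fin n → ℂ} (hf : LocBdd f)
    (hac : ∀ T : ℝ, 0 ≤ T → AbsolutelyContinuousOnInterval H 0 T)
    (hd : ∀ᵐ t ∂(volume.restrict (Ioi (0 : ℝ))), HasDerivAt H (f t) t) (h0 : H 0 = 0) :
    EqOn H (fun t => ∫ τ in (0 : ℝ)..t, f τ) (Ici 0) := by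
  intro T hT
  have hac' := (hac T hT).sub (hf.absolutelyContinuous_of_eqOn_integral (eqOn_refl _ _) hT)
  have hd' : ∀ᵐ t, t ∈ uIcc 0 T → HasDerivAt (H - fun t => ∫ τ in (0 : ℝ)..t, f τ) 0 t := by
    have hne : ∀ᵐ t : ℝ, t ≠ 0 := by simp [ae_iff, measure_singleton]
    filter_upwards [(ae_restrict_iff' measurableSet_Ioi).1 hd,
      (ae_restrict_iff' measurableSet_Ioi).1 hf.ae_hasDerivAt_integral, hne] with t h1 h2 h3 ht
    rw [uIcc_of_le hT] at ht
    have ht0 : t ∈ Ioi (0 : ℝ) := lt_of_le_of_ne ht.1 h3.symm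
    simpa using (h1 ht0).sub (h2 ht0)
  obtain ⟨C, hC⟩ := hac'.const_of_ae_hasDerivAt_zero hd'
  have hC0 := hC 0 left_mem_uIcc
  have hCT := hC T right_mem_uIcc
  simp only [Pi.sub_apply, h0, intervalIntegral.integral_same, sub_zero] at hC0 hCT
  rw [← hC0] at hCT
  exact sub_eq_zero.1 hCT

/-- A function whose Caputo derivative of order `α` is `f` solves the corresponding integral
equation. -/
theorem CaputoRegular.isVolterra (hk : caputoIndex α = m + 1) (hm : 0 < (α - m).re)
    (hκ : ((m + 1 : ℕ) : ℂ) - α = 0 ∨ 0 < (((m + 1 : ℕ) : ℂ) - α).re) (hf : LocBdd f)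
    (hy : CaputoRegular α y)
    (hd : ∀ᵐ t ∂(volume.restrict (Ioi (0 : ℝ))), HasCaputoDerivAt α y (f t) t) :
    IsVolterra α m (fun j => if j ≤ m then derivHalfLine j y 0 else 0) f y := by
  set v : ℕ → Fin n → ℂ := fun j => if j ≤ m then derivHalfLine j y 0 else 0 with hv_def
  have hv : ∀ j, m < j → v j = 0 := fun j hj => if_neg (by omega)
  refine ⟨hk, hm, hκ, hf, hv, ?_⟩
  have hreg := hy.contDiffOn
  rw [hk, Nat.add_sub_cancel] at hreg
  -- F_j is the j-th derivative of y minus its Taylor polynomial; all F_j with j ≤ m vanish at 0, so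
  -- F_0 = I^m F_m.
  set F : ℕ → ℝ → Fin n → ℂ := fun j t => derivHalfLine j y t - taylorPoly v (m + 1) j t with hF
  have hchain : ∀ j < m, ∀ t ∈ Ici (0 : ℝ), HasDerivWithinAt (F j) (F (j + 1) t) (Ici 0) t :=
    fun j hj t ht => (hasDerivWithinAt_iteratedDerivWithin hreg hj ht).sub
      (hasDerivAt_taylorPoly hv j t).hasDerivWithinAt
  have hcont : ∀ j ≤ m, ContinuousOn (F j) (Ici 0) := fun j hj =>
    (hreg.continuousOn_iteratedDerivWithin (by exact_mod_cast hj) (uniqueDiffOn_Ici 0)).sub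
      (continuous_taylorPoly v _ _).continuousOn
  have hF0 : ∀ j ≤ m, F j 0 = 0 := by
    intro j hj
    simp only [hF]
    rw [taylorPoly_zero, hv_def]
    simp [hj]
  have hFm := LocBdd.of_continuousOn (hcont m le_rfl)
  have hchainI := eq_fracIntegral_of_chain hchain hcont fun j hj => hF0 j hj.le
  have hT : (fun τ => y τ - taylorPart (m + 1) y τ) = F 0 := by
    ext1 t
    simp only [hF, derivHalfLine, iteratedDerivWithin_zero]
    congr 1
    refine Finset.sum_congr rfl fun j hj => ?_
    have : j ≤ m := by simpa [Nat.lt_succ_iff] using hj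
    simp [hv_def, this]
  have hm0 : (m : ℂ) = 0 ∨ 0 < (m : ℂ).re := by
    rcases m.eq_zero_or_pos with rfl | h
    · left; simp
    · right; simpa using h
  -- Commuting the integrals, I^(k-α) F_0 = I^m H; thus `H` is the (k-1)-st derivative whose a.e.
  -- derivative is `f`.
  set H := fracIntegral (((m + 1 : ℕ) : ℂ) - α) (F m) with hH_def
  have hHc : ContinuousOn H (Ici 0) := by
    rcases hκ with h | h
    · rw [hH_def, h, fracIntegral_zero_order]
      exact hcont m le_rfl
    · exact continuousOn_fracIntegral h hFm
  have hH0 : H 0 = 0 := by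
    rcases hκ with h | h
    · rw [hH_def, h, fracIntegral_zero_order]
      exact hF0 m le_rfl
    · exact fracIntegral_at_zero h _
  have hcI : EqOn (caputoIntegral α y) (fracIntegral (m : ℂ) H) (Ici 0) := by
    intro t ht
    rw [caputoIntegral, hk, hT, fracIntegral_eqOn hchainI ht,
      fracIntegral_fracIntegral hκ hm0 hFm ht,
      hH_def, fracIntegral_fracIntegral hm0 hκ hFm ht, add_comm]
  have hprim : EqOn (caputoPrimitive α y) H (Ici 0) := by
    intro t ht
    rw [caputoPrimitive, hk, Nat.add_sub_cancel, derivHalfLine, iteratedDerivWithin_congr hcI ht]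
    exact iteratedDerivWithin_fracIntegral_natCast hHc m ht
  have hI : EqOn H (fun t => ∫ τ in (0 : ℝ)..t, f τ) (Ici 0) := by
    have h := eqOn_integral_of_absolutelyContinuous hf hy.absCont hd
      ((hprim (mem_Ici.2 le_rfl)).trans hH0)
    exact fun t ht => (hprim ht).symm.trans (h ht)
  -- Applying I^(α-m) to I^(k-α) F_m = I^1 f completes the order on the left to 1.
  have hone : EqOn (fracIntegral 1 (F m)) (fracIntegral (α - m + 1) f) (Ici 0) := by
    intro t ht
    have e1 : EqOn H (fracIntegral 1 f) (Ici 0) := fun s hs => by rw [hI hs, fracIntegral_one]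
    have h1 := fracIntegral_eqOn (β := α - m) e1 ht
    rw [hH_def, fracIntegral_fracIntegral (Or.inr hm) hκ hFm ht,
      fracIntegral_fracIntegral (Or.inr hm) (Or.inr (by simp)) hf ht] at h1
    have e : α - m + (((m + 1 : ℕ) : ℂ) - α) = 1 := by
      push_cast
      ring
    rwa [e] at h1
  -- Both sides of `hone` are differentiable with continuous derivatives, so differentiating removes
  -- one integral; I^m then gives F_0 = I^α f.
  have hFm_eq : EqOn (F m) (fracIntegral (α - m) f) (Ici 0) := by
    intro t ht
    have h1 := hasDerivWithinAt_fracIntegral (β := α - m) (Or.inr hm) hf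
      (continuousOn_fracIntegral hm hf) ht
    have h2 : HasDerivWithinAt (fracIntegral 1 (F m)) (F m t) (Ici 0) t := by
      have := hasDerivWithinAt_integral_Ici (hcont m le_rfl) ht
      exact this.congr_of_mem (fun s _ => fracIntegral_one _ s) ht
    exact (uniqueDiffOn_Ici 0 t ht).eq_deriv _ h2 (h1.congr_of_mem hone ht)
  intro t ht
  have h1 : F 0 t = fracIntegral α f t := by
    rw [hchainI ht, fracIntegral_eqOn hFm_eq ht,
      fracIntegral_fracIntegral hm0 (Or.inr hm) hf ht, add_sub_cancel]
  have h2 : F 0 t = y t - taylorPoly v (m + 1) 0 t := by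
    simp [hF, derivHalfLine]
  rw [← h1, h2, add_sub_cancel]

end

/-! ### The delayed Volterra equation: uniqueness and existence. -/

section

/-- Multiplication by a real matrix, as a continuous linear map between complex spaces. -/
def matCLM {n m : ℕ} (M : Matrix (Fin n) (Fin m) ℝ) : (Fin m → ℂ) →L[ℂ] (Fin n → ℂ) :=
  (Matrix.mulVecLin (matC M)).toContinuousLinearMap

theorem matCLM_apply {n m : ℕ} (M : Matrix (Fin n) (Fin m) ℝ) (w : Fin m → ℂ) :
    matCLM M w = (matC M).mulVec w := rfl

theorem norm_toC {n : ℕ} (w : Fin n → ℝ) : ‖toC w‖ = ‖w‖ := by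
  simp [toC, Pi.norm_def]

theorem continuous_toC {n : ℕ} : Continuous (toC : (Fin n → ℝ) → Fin n → ℂ) := by
  unfold toC
  fun_prop

/-- A function on `[-h, ∞)` that is measurable and bounded on bounded intervals. -/
structure HistBdd {E : Type*} [NormedAddCommGroup E] (h : ℝ) (x : ℝ → E) : Prop where
  aesm : AEStronglyMeasurable x (volume.restrict (Ici (-h)))
  bdd : ∀ T : ℝ, ∃ M : ℝ, ∀ t ∈ Icc (-h) T, ‖x t‖ ≤ M

theorem HistBdd.locBdd_shift {E : Type*} [NormedAddCommGroup E] {h c : ℝ} {x : ℝ → E}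
    (hx : HistBdd h x) (hc : c ∈ Icc 0 h) : LocBdd (fun t => x (t - c)) where
  aesm := by
    have h1 := (measurePreserving_sub_right (volume : Measure ℝ) c).restrict_preimage
      (measurableSet_Ici (a := -h))
    refine (hx.aesm.comp_measurePreserving h1).mono_measure (Measure.restrict_mono ?_ le_rfl)
    intro t ht
    simp only [mem_preimage, mem_Ici, mem_Ioi] at ht ⊢
    linarith [hc.2]
  bdd T := by
    obtain ⟨M, hM⟩ := hx.bdd T
    exact ⟨M, fun t ht => hM _ ⟨by linarith [hc.2, ht.1], by linarith [hc.1, ht.2]⟩⟩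

theorem HistBdd.of_history {E : Type*} [NormedAddCommGroup E] {h : ℝ} {x ψ : ℝ → E}
    (hψ : AEStronglyMeasurable ψ (volume.restrict (Ico (-h) 0))) {M : ℝ}
    (hM : ∀ t ∈ Ico (-h) 0, ‖ψ t‖ ≤ M) (hx : EqOn x ψ (Ico (-h) 0))
    (hc : ContinuousOn x (Ici 0)) : HistBdd h x where
  aesm := by
    have h1 : AEStronglyMeasurable x (volume.restrict (Ico (-h) 0)) :=
      hψ.congr ((ae_restrict_iff' measurableSet_Ico).2
        (Eventually.of_forall fun t ht => (hx ht).symm))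
    have h2 : AEStronglyMeasurable x (volume.restrict (Ici 0)) :=
      hc.aestronglyMeasurable measurableSet_Ici
    refine (aestronglyMeasurable_union_iff.2 ⟨h1, h2⟩).mono_measure
      (Measure.restrict_mono ?_ le_rfl)
    intro t ht
    rcases lt_or_ge t 0 with h0 | h0
    · exact Or.inl ⟨ht, h0⟩
    · exact Or.inr h0
  bdd T := by
    obtain ⟨M', hM'⟩ := (isCompact_Icc (a := (0 : ℝ)) (b := T)).exists_bound_of_continuousOn
      (hc.mono fun x hx => hx.1)
    refine ⟨max M M', fun t ht => ?_⟩
    rcases lt_or_ge t 0 with h0 | h0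
    · rw [hx ⟨ht.1, h0⟩]
      exact (hM t ⟨ht.1, h0⟩).trans (le_max_left _ _)
    · exact (hM' t ⟨h0, ht.2⟩).trans (le_max_right _ _)

theorem AdmissibleInitial.aestronglyMeasurable {n : ℕ} {h : ℝ} {φ : ℝ → Fin n → ℝ}
    (hφ : AdmissibleInitial h φ) : AEStronglyMeasurable φ (volume.restrict (Icc (-h) 0)) := by
  obtain ⟨-, N, hN, hc, -⟩ := hφ
  -- The exceptional null set need not be measurable; its measurable hull is still null.
  have hmeas : MeasurableSet (Icc (-h) 0 \ toMeasurable volume N) :=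
    measurableSet_Icc.diff (measurableSet_toMeasurable _ _)
  have h1 : ContinuousOn φ (Icc (-h) 0 \ toMeasurable volume N) := fun t ht =>
    (hc t ⟨ht.1, fun h => ht.2 (subset_toMeasurable _ _ h)⟩).mono sdiff_subset
  have h2 := h1.aestronglyMeasurable hmeas (μ := volume)
  have h3 : (Icc (-h) 0 \ toMeasurable volume N : Set ℝ) =ᵐ[volume] Icc (-h) 0 :=
    sdiff_null_ae_eq_self (by rw [measure_toMeasurable, hN])
  rwa [Measure.restrict_congr_set h3] at h2

theorem BoundedPiecewiseContinuous.locBdd {m : ℕ} {u : ℝ → Fin m → ℝ}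
    (hu : BoundedPiecewiseContinuous u) : LocBdd u where
  aesm := by
    set D : Set ℝ := {t ∈ Ici (0 : ℝ) | ¬ ContinuousWithinAt u (Ici 0) t} with hD
    have hDc : D.Countable := by
      have : D ⊆ ⋃ N : ℕ, {t ∈ Icc (0 : ℝ) N | ¬ ContinuousWithinAt u (Ici 0) t} := by
        intro t ht
        obtain ⟨N, hN⟩ := exists_nat_ge t
        exact mem_iUnion.2 ⟨N, ⟨ht.1, hN⟩, ht.2⟩
      exact (countable_iUnion fun N : ℕ => (hu.finite_discontinuities N).countable).mono this
    have h1 : ContinuousOn u (Ioi 0 \ D) := by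
      intro t ht
      have : ContinuousWithinAt u (Ici 0) t := by
        by_contra h
        exact ht.2 ⟨Ioi_subset_Ici_self ht.1, h⟩
      exact this.mono fun s hs => Ioi_subset_Ici_self hs.1
    have h2 := h1.aestronglyMeasurable (measurableSet_Ioi.diff hDc.measurableSet) (μ := volume)
    rwa [Measure.restrict_congr_set (sdiff_null_ae_eq_self (hDc.measure_zero volume))] at h2
  bdd T := by
    obtain ⟨M, hM⟩ := hu.bounded
    exact ⟨M, fun t ht => hM t ht.1.le⟩

variable {n m p : ℕ} {α : ℂ} {A : Fin (p + 1) → Matrix (Fin n) (Fin n) ℝ}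
  {B : Matrix (Fin n) (Fin m) ℝ} {d : Fin (p + 1) → ℝ} {u : ℝ → Fin m → ℝ} {h : ℝ}
  {x y : ℝ → Fin n → ℂ}

theorem locBdd_toC {u : ℝ → Fin m → ℝ} (hu : LocBdd u) : LocBdd (fun t => toC (u t)) where
  aesm := continuous_toC.comp_aestronglyMeasurable hu.aesm
  bdd T := by
    obtain ⟨M, hM⟩ := hu.bdd T
    exact ⟨M, fun t ht => by rw [norm_toC]; exact hM t ht⟩

theorem LocBdd.mulVec {m : ℕ} {f : ℝ → Fin m → ℂ} (hf : LocBdd f) (M : Matrix (Fin n) (Fin m) ℝ) :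
    LocBdd (fun t => (matC M).mulVec (f t)) :=
  hf.clm_comp ((matCLM M).restrictScalars ℝ)

theorem locBdd_systemRHS (hd : ∀ i, d i ∈ Icc 0 h) (hu : LocBdd u) (hx : HistBdd h x) :
    LocBdd (systemRHS A B d u x) :=
  (LocBdd.sum _ fun i _ => (hx.locBdd_shift (hd i)).mulVec (A i)).add ((locBdd_toC hu).mulVec B)

/-- A Lipschitz constant for the delayed terms of the system. -/
def systemNorm (A : Fin (p + 1) → Matrix (Fin n) (Fin n) ℝ) : ℝ := ∑ i, ‖matCLM (A i)‖

theorem systemNorm_nonneg (A : Fin (p + 1) → Matrix (Fin n) (Fin n) ℝ) : 0 ≤ systemNorm A :=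
  Finset.sum_nonneg fun _ _ => norm_nonneg _

theorem norm_sum_mulVec_le {w : Fin (p + 1) → Fin n → ℂ} {M : ℝ} (hw : ∀ i, ‖w i‖ ≤ M) :
    ‖∑ i, (matC (A i)).mulVec (w i)‖ ≤ systemNorm A * M := by
  rw [systemNorm, Finset.sum_mul]
  refine (norm_sum_le _ _).trans (Finset.sum_le_sum fun i _ => ?_)
  exact ((matCLM (A i)).le_opNorm (w i)).trans (by gcongr; exact hw i)

theorem systemRHS_sub (t : ℝ) : systemRHS A B d u x t - systemRHS A B d u y t =
    ∑ i, (matC (A i)).mulVec (x (t - d i) - y (t - d i)) := by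
  simp only [systemRHS, Matrix.mulVec_sub, Finset.sum_sub_distrib]
  abel

/-- The factor 1/2 is the contraction constant; r ≥ 1 lets exp(r t) dominate the exp(t) that bounds
the Taylor polynomial. -/
theorem exists_weight (hα : 0 < α.re) (K : ℝ) :
    ∃ r : ℝ, 1 ≤ r ∧ K * weightBound α r ≤ 1 / 2 := by
  have h := (tendsto_weightBound hα).const_mul K
  rw [mul_zero] at h
  have h2 := h.eventually (Iic_mem_nhds (show (0 : ℝ) < 1 / 2 by norm_num))
  obtain ⟨r, hr, hr1⟩ := (h2.and (eventually_ge_atTop 1)).exists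
  exact ⟨r, hr1, hr⟩

/-- The homogeneous delayed integral equation with zero history has only the zero solution. -/
theorem eqOn_zero_of_volterra (hα : 0 < α.re) (hd : ∀ i, d i ∈ Icc 0 h) {z : ℝ → Fin n → ℂ}
    (hc : ContinuousOn z (Ici 0)) (hz : ∀ t ∈ Ico (-h) 0, z t = 0)
    (heq : ∀ t ∈ Ici (0 : ℝ),
      z t = fracIntegral α (fun s => ∑ i, (matC (A i)).mulVec (z (s - d i))) t) :
    EqOn z 0 (Ici 0) := by
  intro T hT
  obtain ⟨r, hr1, hr⟩ := exists_weight hα (systemNorm A)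
  have hcN : ContinuousOn (fun t => Real.exp (-(r * t)) * ‖z t‖) (Icc 0 T) :=
    (Continuous.continuousOn (by fun_prop)).mul (hc.mono fun s hs => hs.1).norm
  obtain ⟨t₀, ht₀, hmax⟩ := isCompact_Icc.exists_isMaxOn (nonempty_Icc.2 hT) hcN
  -- The maximum of the weighted norm on [0, T]. The equation at the maximizing point t₀ gives μ ≤
  -- μ/2, hence μ = 0.
  set μ : ℝ := Real.exp (-(r * t₀)) * ‖z t₀‖ with hμ
  have hμ0 : 0 ≤ μ := by positivity
  have hbound : ∀ s ∈ Icc (-h) T, ‖z s‖ ≤ μ * Real.exp (r * s) := by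
    intro s hs
    rcases lt_or_ge s 0 with h0 | h0
    · rw [hz s ⟨hs.1, h0⟩, norm_zero]
      positivity
    · have h1 : Real.exp (-(r * s)) * ‖z s‖ ≤ μ := hmax ⟨h0, hs.2⟩
      calc ‖z s‖ = Real.exp (-(r * s)) * ‖z s‖ * Real.exp (r * s) := by
            rw [mul_right_comm, ← Real.exp_add]
            simp
        _ ≤ _ := by gcongr
  have hRHS : ∀ s ∈ Ioc 0 t₀, ‖∑ i, (matC (A i)).mulVec (z (s - d i))‖ ≤
      systemNorm A * μ * Real.exp (r * s) := by
    intro s hs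
    rw [mul_assoc]
    refine norm_sum_mulVec_le fun i => ?_
    have hi := hd i
    refine (hbound _ ⟨by linarith [hi.2, hs.1], by linarith [hi.1, hs.2, ht₀.2]⟩).trans ?_
    gcongr
    linarith [hi.1]
  have h1 := norm_fracIntegral_le hα (by linarith) (mul_nonneg (systemNorm_nonneg A) hμ0) ht₀.1 hRHS
  rw [← heq t₀ ht₀.1] at h1
  have h2 : μ ≤ μ / 2 := by
    calc μ ≤ Real.exp (-(r * t₀)) *
          (systemNorm A * μ * weightBound α r * Real.exp (r * t₀)) := by
          rw [hμ]
          gcongr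
      _ = systemNorm A * weightBound α r * μ * (Real.exp (-(r * t₀)) * Real.exp (r * t₀)) := by ring
      _ = systemNorm A * weightBound α r * μ := by
          rw [← Real.exp_add]
          simp
      _ ≤ 1 / 2 * μ := by gcongr
      _ = μ / 2 := by ring
  have h3 : μ = 0 := by linarith
  have h4 := hbound T ⟨by linarith [(hd 0).1.trans (hd 0).2, mem_Ici.1 hT], le_rfl⟩
  rw [h3, zero_mul] at h4
  simpa using h4

theorem norm_taylorPoly_le (v : ℕ → Fin n → ℂ) (k j : ℕ) {t : ℝ} (ht : 0 ≤ t) :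
    ‖taylorPoly v k j t‖ ≤ (∑ i ∈ Finset.range k, ‖v (i + j)‖) * Real.exp t := by
  rw [taylorPoly, Finset.sum_mul]
  refine (norm_sum_le _ _).trans (Finset.sum_le_sum fun i _ => ?_)
  rw [norm_smul, mul_comm]
  gcongr
  simpa [abs_of_nonneg ht] using Real.pow_div_factorial_le_exp t ht i

/-- The function on the line with history `ψ`, equal to `T + exp (r t) w` on `[0, ∞)`. -/
def extend (ψ T : ℝ → Fin n → ℂ) (r : ℝ) (w : ℝ → Fin n → ℂ) (t : ℝ) : Fin n → ℂ :=
  if t < 0 then ψ t else T t + Real.exp (r * t) • w t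

open scoped BoundedContinuousFunction in
/-- The delayed integral equation has a solution with given history. -/
theorem exists_volterra (hα : 0 < α.re) (hd : ∀ i, d i ∈ Icc 0 h) (hu : LocBdd u)
    {Mu : ℝ} (hMu : ∀ t, 0 ≤ t → ‖u t‖ ≤ Mu) {ψ : ℝ → Fin n → ℂ}
    (hψ : AEStronglyMeasurable ψ (volume.restrict (Ico (-h) 0))) {M : ℝ}
    (hM : ∀ t ∈ Ico (-h) 0, ‖ψ t‖ ≤ M) (v : ℕ → Fin n → ℂ) (k : ℕ) :
    ∃ x : ℝ → Fin n → ℂ, EqOn x ψ (Iio 0) ∧ ContinuousOn x (Ici 0) ∧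
      ∀ t ∈ Ici (0 : ℝ),
        x t = taylorPoly v k 0 t + fracIntegral α (systemRHS A B d u x) t := by
  obtain ⟨r, hr1, hr⟩ := exists_weight hα (systemNorm A)
  have hr0 : 0 < r := by linarith
  set T := taylorPoly v k 0 with hT
  have hext_hist : ∀ w, EqOn (extend ψ T r w) ψ (Iio 0) := fun w t ht => if_pos ht
  have hext_pos : ∀ w, EqOn (extend ψ T r w) (fun t => T t + Real.exp (r * t) • w t) (Ici 0) :=
    fun w t ht => if_neg (not_lt.2 ht)
  have hext_cont : ∀ w, Continuous w → ContinuousOn (extend ψ T r w) (Ici 0) := by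
    intro w hw
    refine ContinuousOn.congr ?_ (hext_pos w)
    have := continuous_taylorPoly v k 0
    exact Continuous.continuousOn (by fun_prop)
  have hHist : ∀ w, Continuous w → HistBdd h (extend ψ T r w) := fun w hw =>
    .of_history hψ hM ((hext_hist w).mono fun t ht => ht.2) (hext_cont w hw)
  have hRHS : ∀ w, Continuous w → LocBdd (systemRHS A B d u (extend ψ T r w)) := fun w hw =>
    locBdd_systemRHS hd hu (hHist w hw)
  have hexp1 : ∀ {s : ℝ}, 0 ≤ s → 1 ≤ Real.exp (r * s) := fun hs =>
    Real.one_le_exp (by positivity)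
  set S := ∑ i ∈ Finset.range k, ‖v (i + 0)‖ with hS
  have hS0 : 0 ≤ S := Finset.sum_nonneg fun _ _ => norm_nonneg _
  -- History, polynomial, control and unknown all grow at most like exp(r s), so the weighted
  -- operator maps bounded functions to bounded functions.
  have hgrow : ∀ w : ℝ →ᵇ (Fin n → ℂ), ∃ C : ℝ, 0 ≤ C ∧ ∀ s, 0 < s →
      ‖systemRHS A B d u (extend ψ T r w) s‖ ≤ C * Real.exp (r * s) := by
    intro w
    have hMu0 : 0 ≤ Mu := (norm_nonneg _).trans (hMu 0 le_rfl)
    refine ⟨systemNorm A * (|M| + S + ‖w‖) + ‖matCLM B‖ * Mu, ?_, fun s hs => ?_⟩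
    · have := systemNorm_nonneg A
      positivity
    · rw [add_mul, mul_assoc, mul_assoc]
      refine (norm_add_le _ _).trans (add_le_add (norm_sum_mulVec_le fun i => ?_) ?_)
      · have hi := hd i
        rcases lt_or_ge (s - d i) 0 with h0 | h0
        · rw [hext_hist w h0]
          calc ‖ψ (s - d i)‖ ≤ M := hM _ ⟨by linarith [hi.2], h0⟩
            _ ≤ |M| * 1 := by rw [mul_one]; exact le_abs_self M
            _ ≤ (|M| + S + ‖w‖) * Real.exp (r * s) := by
              gcongr
              · linarith [norm_nonneg w]
              · exact hexp1 hs.le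
        · rw [hext_pos w h0]
          have e1 : Real.exp (s - d i) ≤ Real.exp (r * s) := by
            apply Real.exp_le_exp.2
            nlinarith [hi.1]
          have e2 : Real.exp (r * (s - d i)) ≤ Real.exp (r * s) := by
            apply Real.exp_le_exp.2
            nlinarith [hi.1]
          calc ‖T (s - d i) + Real.exp (r * (s - d i)) • w (s - d i)‖
              ≤ S * Real.exp (s - d i) + Real.exp (r * (s - d i)) * ‖w‖ := by
                refine (norm_add_le _ _).trans (add_le_add (norm_taylorPoly_le v k 0 h0) ?_)
                rw [norm_smul, Real.norm_of_nonneg (Real.exp_pos _).le]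
                gcongr
                exact w.norm_coe_le_norm _
            _ ≤ S * Real.exp (r * s) + Real.exp (r * s) * ‖w‖ := by gcongr
            _ ≤ (|M| + S + ‖w‖) * Real.exp (r * s) := by
                nlinarith [abs_nonneg M, Real.exp_pos (r * s)]
      · refine ((matCLM B).le_opNorm _).trans ?_
        gcongr
        rw [norm_toC]
        calc ‖u s‖ ≤ Mu * 1 := by rw [mul_one]; exact hMu s hs.le
          _ ≤ Mu * Real.exp (r * s) := by
            gcongr
            exact hexp1 hs.le
  -- The unknown is w = exp(-r t)(x - T). Evaluating at `max t 0` extends the operator to the line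
  -- (by 0 for t ≤ 0), so that the fixed point is sought in the complete space of bounded continuous
  -- functions on ℝ.
  set Ψ : (ℝ → Fin n → ℂ) → ℝ → Fin n → ℂ := fun w t => Real.exp (-(r * max t 0)) •
    fracIntegral α (systemRHS A B d u (extend ψ T r w)) (max t 0) with hΨ
  have hweight : ∀ {a b t : ℝ}, a ≤ b * Real.exp (r * t) → Real.exp (-(r * t)) * a ≤ b := by
    intro a b t hab
    calc Real.exp (-(r * t)) * a ≤ Real.exp (-(r * t)) * (b * Real.exp (r * t)) := by gcongr
      _ = b * (Real.exp (-(r * t)) * Real.exp (r * t)) := by ring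
      _ = b := by
        rw [← Real.exp_add]
        simp
  have hΨc : ∀ w : ℝ →ᵇ (Fin n → ℂ), Continuous (Ψ w) := by
    intro w
    have h1 : Continuous fun t : ℝ =>
        fracIntegral α (systemRHS A B d u (extend ψ T r w)) (max t 0) :=
      (continuousOn_fracIntegral hα (hRHS w w.continuous)).comp_continuous (by fun_prop)
        fun t => mem_Ici.2 (le_max_right _ _)
    have h2 : Continuous fun t : ℝ => Real.exp (-(r * max t 0)) := by fun_prop
    exact h2.smul h1
  have hΨb : ∀ w : ℝ →ᵇ (Fin n → ℂ), ∃ C, ∀ t, ‖Ψ w t‖ ≤ C := by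
    intro w
    obtain ⟨C, hC0, hC⟩ := hgrow w
    refine ⟨C * weightBound α r, fun t => ?_⟩
    have := norm_fracIntegral_le hα hr0 hC0 (le_max_right t 0) fun s hs => hC s hs.1
    simp only [hΨ, norm_smul, Real.norm_of_nonneg (Real.exp_pos _).le]
    exact hweight this
  choose C hC using hΨb
  set Θ : (ℝ →ᵇ (Fin n → ℂ)) → (ℝ →ᵇ (Fin n → ℂ)) := fun w =>
    BoundedContinuousFunction.ofNormedAddCommGroup (Ψ w) (hΨc w) (C w) (hC w) with hΘ
  have hcontr : ContractingWith (1 / 2) Θ := by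
    refine ⟨by rw [← NNReal.coe_lt_coe]; norm_num, LipschitzWith.of_dist_le_mul fun w w' => ?_⟩
    have hnn : (0 : ℝ) ≤ ((1 / 2 : NNReal) : ℝ) * dist w w' := by positivity
    refine (BoundedContinuousFunction.dist_le hnn).2 fun t => ?_
    have hdiff : ∀ s ∈ Ioc 0 (max t 0), ‖systemRHS A B d u (extend ψ T r w) s -
        systemRHS A B d u (extend ψ T r w') s‖ ≤ systemNorm A * dist w w' * Real.exp (r * s) := by
      intro s hs
      rw [systemRHS_sub, mul_assoc]
      refine norm_sum_mulVec_le fun i => ?_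
      rcases lt_or_ge (s - d i) 0 with h0 | h0
      -- The history does not depend on w and cancels; so do the polynomial and the control.
      · rw [hext_hist w h0, hext_hist w' h0, sub_self, norm_zero]
        positivity
      · rw [hext_pos w h0, hext_pos w' h0]
        simp only [add_sub_add_left_eq_sub]
        rw [← smul_sub, norm_smul, Real.norm_of_nonneg (Real.exp_pos _).le, ← dist_eq_norm,
          mul_comm]
        gcongr
        · exact BoundedContinuousFunction.dist_coe_le_dist _
        · linarith [(hd i).1]
    have hle := norm_fracIntegral_le hα hr0 (mul_nonneg (systemNorm_nonneg A) dist_nonneg)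
      (le_max_right t 0) hdiff
    rw [fracIntegral_sub (Or.inr hα) (hRHS w w.continuous) (hRHS w' w'.continuous)
      (le_max_right t 0)] at hle
    have e : dist (Θ w t) (Θ w' t) = Real.exp (-(r * max t 0)) *
        ‖fracIntegral α (systemRHS A B d u (extend ψ T r w)) (max t 0) -
          fracIntegral α (systemRHS A B d u (extend ψ T r w')) (max t 0)‖ := by
      rw [dist_eq_norm]
      simp only [hΘ, BoundedContinuousFunction.coe_ofNormedAddCommGroup, hΨ]
      rw [← smul_sub, norm_smul, Real.norm_of_nonneg (Real.exp_pos _).le]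
    rw [e]
    refine (hweight hle).trans ?_
    calc systemNorm A * dist w w' * weightBound α r
        = systemNorm A * weightBound α r * dist w w' := by ring
      _ ≤ 1 / 2 * dist w w' := by gcongr
      _ = _ := by norm_num
  have hfix : Θ (hcontr.fixedPoint Θ) = hcontr.fixedPoint Θ := hcontr.fixedPoint_isFixedPt
  set w := hcontr.fixedPoint Θ with hw
  refine ⟨extend ψ T r w, hext_hist w, hext_cont w w.continuous, fun t ht => ?_⟩
  rw [hext_pos w ht]
  simp only
  congr 1
  have h1 : w t = Ψ w t := by
    conv_lhs => rw [← hfix]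
    rfl
  rw [h1]
  simp only [hΨ, max_eq_left (mem_Ici.1 ht)]
  rw [smul_smul, ← Real.exp_add]
  simp

end

/-! ### Mittag-Leffler series and convolution with the kernel. -/

section

variable {n : ℕ} {α β : ℂ} {f x : ℝ → Fin n → ℂ}

theorem re_mul_natCast_add_pos (hα : 0 < α.re) (hβ : 0 < β.re) (l : ℕ) :
    0 < (α * l + β).re := by
  have : (α * l).re = α.re * l := by simp
  rw [Complex.add_re, this]
  positivity

/-- The quotient of values of the Gamma function at points differing by `α` tends to `0`. -/
theorem norm_Gamma_div_le (hα : 0 < α.re) {r : ℝ} (hr : 0 < r) {z : ℂ} (hz : r + 1 ≤ z.re) :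
    ‖(Complex.Gamma (z + α))⁻¹‖ ≤ weightBound α r * ‖(Complex.Gamma z)⁻¹‖ := by
  have hz0 : 0 < z.re := by linarith
  have hzα : 0 < (z + α).re := by
    rw [Complex.add_re]
    linarith
  -- At t = 1, I^α s^(z-1) equals Γ(z)/Γ(z+α). On (0, 1] one has |s^(z-1)| ≤ s^r ≤ exp(-r) exp(r s)
  -- from log s ≤ s - 1, and the factor exp(-r) cancels the weight at 1.
  have h := norm_fracIntegral_le (n := 1) (β := α) (f := fun s _ => (s : ℂ) ^ (z - 1)) (r := r)
    (M := Real.exp (-r)) (t := 1) hα hr (Real.exp_pos _).le zero_le_one (by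
      intro s hs
      rw [pi_norm_const, Complex.norm_cpow_eq_rpow_re_of_pos hs.1, Complex.sub_re, Complex.one_re]
      calc s ^ (z.re - 1) ≤ s ^ r := Real.rpow_le_rpow_of_exponent_ge hs.1 hs.2 (by linarith)
        _ = Real.exp (Real.log s * r) := Real.rpow_def_of_pos hs.1 r
        _ ≤ Real.exp (-r + r * s) := by
          apply Real.exp_le_exp.2
          nlinarith [Real.log_le_sub_one_of_pos hs.1]
        _ = _ := Real.exp_add _ _)
  have hval : fracIntegral α (fun s (_ : Fin 1) => (s : ℂ) ^ (z - 1)) 1 =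
      fun _ => Complex.Gamma z * (Complex.Gamma (z + α))⁻¹ := by
    rw [fracIntegral_eq hα]
    have h1 : ∀ τ : ℝ, (((1 - τ : ℝ) : ℂ) ^ (α - 1)) • (fun _ : Fin 1 => (τ : ℂ) ^ (z - 1)) =
        ((τ : ℂ) ^ (z - 1) * (((1 : ℝ) : ℂ) - τ) ^ (α - 1)) • (fun _ : Fin 1 => (1 : ℂ)) := by
      intro τ
      ext i
      simp [mul_comm]
    simp only [h1]
    rw [intervalIntegral.integral_smul_const, Complex.betaIntegral_scaled z α one_pos, smul_smul]
    have hB := Complex.Gamma_mul_Gamma_eq_betaIntegral hz0 hα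
    have h2 := Complex.Gamma_ne_zero_of_re_pos hα
    have h3 := Complex.Gamma_ne_zero_of_re_pos hzα
    ext i
    simp only [Pi.smul_apply, smul_eq_mul, mul_one, Complex.ofReal_one, Complex.one_cpow, one_mul]
    field_simp
    rw [mul_comm, ← hB]
    ring
  rw [hval, pi_norm_const, norm_mul] at h
  have h4 : 0 < ‖Complex.Gamma z‖ := norm_pos_iff.2 (Complex.Gamma_ne_zero_of_re_pos hz0)
  have h5 : Real.exp (-r) * weightBound α r * Real.exp (r * 1) = weightBound α r := by
    rw [mul_right_comm, ← Real.exp_add]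
    simp
  rw [h5] at h
  rw [norm_inv (Complex.Gamma z), ← div_eq_mul_inv, le_div_iff₀ h4, mul_comm]
  exact h

/-- Ratio test: consecutive arguments of Γ differ by α, and r is chosen with C · `weightBound α r` ≤
1/2. The Gamma estimate applies as soon as Re(α l + β) ≥ r + 1. -/
theorem summable_pow_mul_inv_Gamma (hα : 0 < α.re) (hβ : 0 < β.re) {C : ℝ} (hC : 0 ≤ C) :
    Summable fun l : ℕ => C ^ l * ‖(Complex.Gamma (α * l + β))⁻¹‖ := by
  obtain ⟨r, hr1, hr⟩ := exists_weight hα C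
  refine summable_of_ratio_norm_eventually_le (r := 1 / 2) (by norm_num) ?_
  obtain ⟨N, hN⟩ := exists_nat_ge ((r + 1) / α.re)
  filter_upwards [eventually_ge_atTop N] with l hl
  have hz : r + 1 ≤ (α * l + β).re := by
    have h1 : (α * l).re = α.re * l := by simp
    rw [Complex.add_re, h1]
    rw [div_le_iff₀ hα] at hN
    have h2 : (N : ℝ) ≤ l := by exact_mod_cast hl
    nlinarith
  have h := norm_Gamma_div_le hα (by linarith) hz
  have e : α * (l + 1 : ℕ) + β = α * l + β + α := by
    push_cast
    ring
  rw [e, Real.norm_of_nonneg (by positivity), Real.norm_of_nonneg (by positivity)]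
  calc C ^ (l + 1) * ‖(Complex.Gamma (α * l + β + α))⁻¹‖
      ≤ C ^ (l + 1) * (weightBound α r * ‖(Complex.Gamma (α * l + β))⁻¹‖) := by gcongr
    _ = C * weightBound α r * (C ^ l * ‖(Complex.Gamma (α * l + β))⁻¹‖) := by ring
    _ ≤ _ := by gcongr

theorem exists_norm_pow_apply_le (Z : Matrix (Fin n) (Fin n) ℂ) :
    ∃ C : ℝ, 0 ≤ C ∧ ∀ l i j, ‖(Z ^ l) i j‖ ≤ C ^ l := by
  set C := ∑ i, ∑ j, ‖Z i j‖ with hC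
  have hC0 : 0 ≤ C := Finset.sum_nonneg fun _ _ => Finset.sum_nonneg fun _ _ => norm_nonneg _
  refine ⟨C, hC0, fun l => ?_⟩
  induction l with
  | zero =>
    intro i j
    simp only [pow_zero, Matrix.one_apply]
    split_ifs <;> simp
  | succ l ih =>
    intro i j
    rw [pow_succ, Matrix.mul_apply, pow_succ, hC, Finset.mul_sum]
    refine (norm_sum_le _ _).trans (Finset.sum_le_sum fun k _ => ?_)
    rw [norm_mul]
    gcongr
    · exact ih i k
    · exact Finset.single_le_sum (f := fun j => ‖Z k j‖) (fun _ _ => norm_nonneg _)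
        (Finset.mem_univ j)

theorem summable_mittagLefflerTerm (hα : 0 < α.re) (hβ : 0 < β.re)
    (Z : Matrix (Fin n) (Fin n) ℂ) : Summable (mittagLefflerTerm α β Z) := by
  obtain ⟨C, hC0, hC⟩ := exists_norm_pow_apply_le Z
  refine Pi.summable.2 fun i => Pi.summable.2 fun j => ?_
  refine Summable.of_norm_bounded (summable_pow_mul_inv_Gamma hα hβ hC0) fun l => ?_
  rw [mittagLefflerTerm, Matrix.smul_apply, smul_eq_mul, norm_mul, mul_comm]
  gcongr
  exact hC l i j

theorem matCLM_pow_apply (M : Matrix (Fin n) (Fin n) ℝ) (l : ℕ) (w : Fin n → ℂ) :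
    (matCLM M ^ l) w = (matC M ^ l).mulVec w := by
  induction l generalizing w with
  | zero => simp
  | succ l ih =>
    rw [pow_succ, mul_apply_eq_comp, ih, matCLM_apply, pow_succ, Matrix.mulVec_mulVec]

theorem mittagLefflerTerm_scaledMatrix_mulVec (M : Matrix (Fin n) (Fin n) ℝ) (t : ℝ) (l : ℕ)
    (w : Fin n → ℂ) : (mittagLefflerTerm α β (scaledMatrix α M t) l).mulVec w =
      ((Complex.Gamma (α * l + β))⁻¹ * (t : ℂ) ^ (α * l)) • (matCLM M ^ l) w := by
  rw [mittagLefflerTerm, scaledMatrix, smul_pow, smul_smul, Matrix.smul_mulVec, matCLM_pow_apply,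
    Complex.cpow_mul_nat]

theorem hasSum_mittagLeffler_mulVec (hα : 0 < α.re) (hβ : 0 < β.re)
    (M : Matrix (Fin n) (Fin n) ℝ) (t : ℝ) (w : Fin n → ℂ) :
    HasSum (fun l : ℕ => ((Complex.Gamma (α * l + β))⁻¹ * (t : ℂ) ^ (α * l)) • (matCLM M ^ l) w)
      ((mittagLeffler α β (scaledMatrix α M t)).mulVec w) := by
  have h := (summable_mittagLefflerTerm hα hβ (scaledMatrix α M t)).hasSum.map
    (Matrix.mulVec.addMonoidHomLeft w) (Continuous.matrix_mulVec continuous_id continuous_const)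
  refine h.congr_fun ?_
  intro l
  exact (mittagLefflerTerm_scaledMatrix_mulVec M t l w).symm

theorem hasSum_Phi_mulVec (hα : 0 < α.re) (M : Matrix (Fin n) (Fin n) ℝ) {s : ℝ} (hs : 0 < s)
    (w : Fin n → ℂ) :
    HasSum (fun l : ℕ => ((Complex.Gamma (α * l + α))⁻¹ * (s : ℂ) ^ (α * l + α - 1)) •
      (matCLM M ^ l) w) ((Phi α M s).mulVec w) := by
  have h := (hasSum_mittagLeffler_mulVec hα hα M s w).const_smul ((s : ℂ) ^ (α - 1))
  rw [Phi, if_neg (not_lt.2 hs.le), Matrix.smul_mulVec]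
  refine h.congr_fun fun l => ?_
  have hs' : (s : ℂ) ≠ 0 := by exact_mod_cast hs.ne'
  rw [smul_smul, add_sub_assoc, Complex.cpow_add _ _ hs']
  congr 1
  ring

/-- Each term of the series is I^(α l) of the monomial t^j/j!, which is how iterating the Volterra
equation produces this kernel. The term l = 0 is separate because I^0 is the identity by definition.
-/
theorem hasSum_PhiInit_mulVec (hα : 0 < α.re) (M : Matrix (Fin n) (Fin n) ℝ) (j : ℕ) {t : ℝ}
    (ht : 0 ≤ t) (w : Fin n → ℂ) :
    HasSum (fun l : ℕ => (matCLM M ^ l)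
      (fracIntegral (α * l) (fun s => ((s : ℂ) ^ j / (j.factorial : ℂ)) • w) t))
      ((PhiInit α M j t).mulVec w) := by
  have hj : 0 < ((j : ℂ) + 1).re := by
    simp only [Complex.add_re, Complex.natCast_re, Complex.one_re]
    positivity
  have h := (hasSum_mittagLeffler_mulVec hα hj M t w).const_smul ((t : ℂ) ^ j)
  rw [PhiInit, if_neg (not_lt.2 ht), Matrix.smul_mulVec]
  refine h.congr_fun fun l => ?_
  rcases l.eq_zero_or_pos with rfl | hl
  · simp only [Nat.cast_zero, mul_zero, fracIntegral_zero_order, pow_zero, zero_add,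
      Complex.cpow_zero, mul_one, smul_smul, Complex.Gamma_nat_eq_factorial, div_eq_mul_inv]
    rfl
  · have hl' : 0 < (α * l).re := by
      have h1 : (α * l).re = α.re * l := by simp
      rw [h1]
      positivity
    rw [fracIntegral_monomial hl' j w ht, map_smul, smul_smul, ← add_assoc]
    congr 1
    ring

/-- The convolution of `Φ_α` with a locally bounded function exists, and is the sum of a series of
fractional integrals. -/
theorem intervalIntegrable_and_hasSum_Phi (hα : 0 < α.re) (M : Matrix (Fin n) (Fin n) ℝ)
    (hf : LocBdd f) {t : ℝ} (ht : 0 ≤ t) :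
    IntervalIntegrable (fun τ => (Phi α M (t - τ)).mulVec (f τ)) volume 0 t ∧
      HasSum (fun l : ℕ => (matCLM M ^ l) (fracIntegral (α * l + α) f t))
        (∫ τ in (0 : ℝ)..t, (Phi α M (t - τ)).mulVec (f τ)) := by
  obtain ⟨K, hK0, hK⟩ := hf.exists_bound t
  set L := matCLM M with hL
  set c : ℕ → ℝ := fun l => (t ^ α.re * ‖L‖) ^ l * ‖(Complex.Gamma (α * l + α))⁻¹‖ with hc
  have hcs : Summable c := summable_pow_mul_inv_Gamma hα hα (by positivity)
  set F : ℕ → ℝ → Fin n → ℂ := fun l τ => (Complex.Gamma (α * l + α))⁻¹ •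
    (((t - τ : ℝ) : ℂ) ^ (α * l + α - 1)) • (L ^ l) (f τ) with hF
  have hpos : ∀ l : ℕ, 0 < (α * l + α).re := re_mul_natCast_add_pos hα hα
  have hLf : ∀ l, LocBdd fun τ => (L ^ l) (f τ) := fun l =>
    hf.clm_comp ((L ^ l).restrictScalars ℝ)
  have hFint : ∀ l, IntervalIntegrable (F l) volume 0 t := fun l =>
    ((hLf l).intervalIntegrable_kernel_smul (hpos l) ht).smul (Complex.Gamma (α * l + α))⁻¹
  have hFmeas : ∀ l, AEStronglyMeasurable (F l) (volume.restrict (uIoc 0 t)) := fun l =>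
    (intervalIntegrable_iff.1 (hFint l)).aestronglyMeasurable
  have hne : ∀ᵐ τ : ℝ, τ ≠ t := by simp [ae_iff, measure_singleton]
  -- Bounding (t - τ)^(l Re α) by t^(l Re α) leaves a single integrable singularity common to all
  -- terms, times a summable sequence: the majorant for dominated convergence.
  have hFb : ∀ l, ∀ᵐ τ, τ ∈ uIoc 0 t → ‖F l τ‖ ≤ (t - τ) ^ (α.re - 1) * K * c l := by
    intro l
    filter_upwards [hne] with τ hτt hτ
    rw [uIoc_of_le ht] at hτ
    have hlt : 0 < t - τ := sub_pos.2 (lt_of_le_of_ne hτ.2 hτt)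
    have e : (t - τ) ^ (α * l + α - 1).re = (t - τ) ^ (α.re - 1) * ((t - τ) ^ α.re) ^ l := by
      rw [← Real.rpow_natCast, ← Real.rpow_mul hlt.le, ← Real.rpow_add hlt]
      congr 1
      simp
      ring
    rw [hF]
    simp only
    rw [norm_smul, norm_smul, Complex.norm_cpow_eq_rpow_re_of_pos hlt, e]
    calc ‖(Complex.Gamma (α * l + α))⁻¹‖ * ((t - τ) ^ (α.re - 1) * ((t - τ) ^ α.re) ^ l *
          ‖(L ^ l) (f τ)‖)
        ≤ ‖(Complex.Gamma (α * l + α))⁻¹‖ * ((t - τ) ^ (α.re - 1) * (t ^ α.re) ^ l *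
          (‖L‖ ^ l * K)) := by
          gcongr
          · linarith [hτ.1]
          · refine ((L ^ l).le_opNorm _).trans ?_
            gcongr
            -- For l = 0 only ‖id‖ ≤ 1 is available, since the space is trivial when n = 0.
            · rcases l.eq_zero_or_pos with rfl | hl
              · rw [pow_zero, pow_zero]
                exact ContinuousLinearMap.norm_id_le
              · exact norm_pow_le' L hl
            · exact hK τ hτ
      _ = _ := by
          simp only [hc, mul_pow]
          ring
  have hlim : ∀ᵐ τ, τ ∈ uIoc 0 t → HasSum (fun l => F l τ) ((Phi α M (t - τ)).mulVec (f τ)) := by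
    filter_upwards [hne] with τ hτt hτ
    rw [uIoc_of_le ht] at hτ
    have hlt : 0 < t - τ := sub_pos.2 (lt_of_le_of_ne hτ.2 hτt)
    refine (hasSum_Phi_mulVec hα M hlt (f τ)).congr_fun fun l => ?_
    rw [mul_smul]
  have hbsum : ∀ τ, HasSum (fun l => (t - τ) ^ (α.re - 1) * K * c l)
      ((t - τ) ^ (α.re - 1) * K * ∑' l, c l) := fun τ => hcs.hasSum.mul_left _
  have hbint : IntervalIntegrable (fun τ => (t - τ) ^ (α.re - 1) * K * ∑' l, c l) volume 0 t := by
    have h1 := (intervalIntegral.intervalIntegrable_rpow' (a := t) (b := 0) (r := α.re - 1)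
      (by linarith)).comp_sub_left t
    simp only [sub_self, sub_zero] at h1
    exact (h1.mul_const K).mul_const _
  constructor
  · rw [intervalIntegrable_iff] at hbint ⊢
    refine Integrable.mono' hbint ?_ ?_
    · refine aestronglyMeasurable_of_tendsto_ae atTop
        (f := fun N τ => ∑ l ∈ Finset.range N, F l τ) (fun N => ?_) ?_
      · exact Finset.aestronglyMeasurable_fun_sum _ fun l _ => hFmeas l
      · rw [ae_restrict_iff' measurableSet_uIoc]
        filter_upwards [hlim] with τ hτ hτ'
        exact (hτ hτ').tendsto_sum_nat
    · rw [ae_restrict_iff' measurableSet_uIoc]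
      filter_upwards [hlim, ae_all_iff.2 hFb] with τ h1 h2 hτ
      rw [← (h1 hτ).tsum_eq]
      exact tsum_of_norm_bounded (hbsum τ) fun l => h2 l hτ
  · have h := intervalIntegral.hasSum_integral_of_dominated_convergence
      (fun l τ => (t - τ) ^ (α.re - 1) * K * c l) hFmeas hFb
      (Eventually.of_forall fun τ _ => (hbsum τ).summable)
      (by simpa only [fun τ => (hbsum τ).tsum_eq] using hbint) hlim
    refine h.congr_fun fun l => ?_
    rw [← fracIntegral_clm (Or.inr (hpos l)) (L ^ l) hf ht, fracIntegral_eq (hpos l), hF]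
    simp only
    rw [intervalIntegral.integral_smul]

end

/-! ### Variation of constants, and reality of the solution. -/

section

variable {n : ℕ} {α β : ℂ} {f g x : ℝ → Fin n → ℂ}

theorem fracIntegral_sum (hβ : β = 0 ∨ 0 < β.re) {ι : Type*} (s : Finset ι)
    {F : ι → ℝ → Fin n → ℂ} (hF : ∀ i, LocBdd (F i)) {t : ℝ} (ht : 0 ≤ t) :
    fracIntegral β (fun τ => ∑ i ∈ s, F i τ) t = ∑ i ∈ s, fracIntegral β (F i) t := by
  classical
  induction s using Finset.induction_on with
  | empty =>
    rcases hβ with rfl | hβ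
    · simp [fracIntegral_zero_order]
    · simp [fracIntegral_eq hβ]
  | insert a s ha ih =>
    simp only [Finset.sum_insert ha]
    rw [fracIntegral_add hβ (hF a) (.sum s fun i _ => hF i) ht, ih]

theorem mul_natCast_eq_zero_or_re_pos (hα : 0 < α.re) (N : ℕ) :
    α * N = 0 ∨ 0 < (α * N).re := by
  rcases N.eq_zero_or_pos with rfl | hN
  · left; simp
  · right
    have h1 : (α * N).re = α.re * N := by simp
    rw [h1]
    positivity

/-- Finite iteration of the equation `x = T + I^α (L x + F)`. -/
theorem iterate_volterra (hα : 0 < α.re) (L : (Fin n → ℂ) →L[ℂ] (Fin n → ℂ))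
    {T F : ℝ → Fin n → ℂ} (hT : LocBdd T) (hF : LocBdd F) (hx : LocBdd x)
    (heq : ∀ t ∈ Ici (0 : ℝ), x t = T t + fracIntegral α (fun s => L (x s) + F s) t)
    (N : ℕ) {t : ℝ} (ht : 0 ≤ t) :
    x t = ∑ l ∈ Finset.range N, (L ^ l) (fracIntegral (α * l) T t) +
      ∑ l ∈ Finset.range N, (L ^ l) (fracIntegral (α * l + α) F t) +
      (L ^ N) (fracIntegral (α * N) x t) := by
  induction N with
  | zero => simp [fracIntegral_zero_order]
  | succ N ih =>
    rw [ih, Finset.sum_range_succ, Finset.sum_range_succ]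
    have hN := mul_natCast_eq_zero_or_re_pos hα N
    have hLx : LocBdd fun s => L (x s) := hx.clm_comp (L.restrictScalars ℝ)
    have heq' : EqOn x (fun s => T s + (fracIntegral α F s + fracIntegral α (fun s => L (x s)) s))
        (Ici 0) := by
      intro s hs
      rw [heq s hs, fracIntegral_add (Or.inr hα) hLx hF hs,
        add_comm (fracIntegral α (fun s => L (x s)) s)]
    have h1 : fracIntegral (α * N) x t = fracIntegral (α * N) T t +
        (fracIntegral (α * N + α) F t + L (fracIntegral (α * N + α) x t)) := by
      have hIF := hF.fracIntegral (Or.inr hα)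
      have hIx := hLx.fracIntegral (Or.inr hα)
      have hpos : α * N + α = 0 ∨ 0 < (α * N + α).re := Or.inr (re_mul_natCast_add_pos hα hα N)
      rw [fracIntegral_eqOn heq' ht, fracIntegral_add hN hT (hIF.add hIx) ht,
        fracIntegral_add hN hIF hIx ht, fracIntegral_fracIntegral hN (Or.inr hα) hF ht,
        fracIntegral_fracIntegral hN (Or.inr hα) hLx ht, fracIntegral_clm hpos L hx ht]
    have e : α * ((N + 1 : ℕ) : ℂ) = α * N + α := by
      push_cast
      ring
    have h2 : (L ^ N) (fracIntegral (α * N) x t) = (L ^ N) (fracIntegral (α * N) T t) +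
        (L ^ N) (fracIntegral (α * N + α) F t) +
        (L ^ (N + 1)) (fracIntegral (α * ((N + 1 : ℕ) : ℂ)) x t) := by
      rw [h1, e, map_add, map_add, pow_succ, mul_apply_eq_comp, add_assoc]
    rw [h2]
    abel

theorem norm_fracIntegral_iterate_le (hα : 0 < α.re) {r M t : ℝ} (hr : 0 < r) (hM : 0 ≤ M)
    (hx : LocBdd x) (hb : ∀ s ∈ Icc 0 t, ‖x s‖ ≤ M * Real.exp (r * s)) (N : ℕ) :
    ∀ s ∈ Icc 0 t,
      ‖fracIntegral (α * N) x s‖ ≤ M * weightBound α r ^ N * Real.exp (r * s) := by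
  induction N with
  | zero => simpa [fracIntegral_zero_order] using hb
  | succ N ih =>
    intro s hs
    have hN := mul_natCast_eq_zero_or_re_pos hα N
    have e : α * ((N + 1 : ℕ) : ℂ) = α + α * N := by
      push_cast
      ring
    have hw := weightBound_nonneg hα hr
    rw [e, ← fracIntegral_fracIntegral (Or.inr hα) hN hx hs.1, pow_succ, ← mul_assoc]
    exact norm_fracIntegral_le hα hr (by positivity) hs.1 fun τ hτ =>
      ih τ ⟨hτ.1.le, hτ.2.trans hs.2⟩

/-- Each further I^α costs a factor `weightBound α r` and each L a factor ‖L‖; with r chosen so that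
the product is at most 1/2, the remainder decays like 2^(-N). -/
theorem tendsto_iterate_remainder (hα : 0 < α.re) (L : (Fin n → ℂ) →L[ℂ] (Fin n → ℂ))
    (hx : ContinuousOn x (Ici 0)) {t : ℝ} (ht : 0 ≤ t) :
    Tendsto (fun N : ℕ => (L ^ N) (fracIntegral (α * N) x t)) atTop (𝓝 0) := by
  obtain ⟨r, hr1, hr⟩ := exists_weight hα ‖L‖
  have hr0 : 0 < r := by linarith
  obtain ⟨M, hM⟩ := (isCompact_Icc (a := (0 : ℝ)) (b := t)).exists_bound_of_continuousOn
    (hx.mono fun x hx => hx.1)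
  have hM0 : 0 ≤ M := (norm_nonneg _).trans (hM 0 ⟨le_rfl, ht⟩)
  have hb : ∀ s ∈ Icc 0 t, ‖x s‖ ≤ M * Real.exp (r * s) := fun s hs =>
    (hM s hs).trans (le_mul_of_one_le_right hM0 (Real.one_le_exp (mul_nonneg hr0.le hs.1)))
  have hw := weightBound_nonneg hα hr0
  have hlim : Tendsto (fun N : ℕ => (1 / 2 : ℝ) ^ N * (M * Real.exp (r * t))) atTop (𝓝 0) := by
    simpa using (tendsto_pow_atTop_nhds_zero_of_lt_one (r := (1 / 2 : ℝ)) (by norm_num)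
      (by norm_num)).mul_const (M * Real.exp (r * t))
  refine squeeze_zero_norm (fun N => ?_) hlim
  have hLN : ‖L ^ N‖ ≤ ‖L‖ ^ N := by
    rcases N.eq_zero_or_pos with rfl | hN
    · rw [pow_zero, pow_zero]
      exact ContinuousLinearMap.norm_id_le
    · exact norm_pow_le' L hN
  calc ‖(L ^ N) (fracIntegral (α * N) x t)‖
      ≤ ‖L‖ ^ N * (M * weightBound α r ^ N * Real.exp (r * t)) :=
        ((L ^ N).le_opNorm _).trans (by
          gcongr
          exact norm_fracIntegral_iterate_le hα hr0 hM0 (.of_continuousOn hx) hb N t ⟨ht, le_rfl⟩)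
    _ = (‖L‖ * weightBound α r) ^ N * (M * Real.exp (r * t)) := by
        rw [mul_pow]
        ring
    _ ≤ _ := by gcongr

/-- The variation of constants formula for `x = ∑_{j<k} v_j t^j / j! + I^α (M x + F)`. -/
theorem variation_of_constants (hα : 0 < α.re) (M : Matrix (Fin n) (Fin n) ℝ)
    {F : ℝ → Fin n → ℂ} {v : ℕ → Fin n → ℂ} {k : ℕ} (hF : LocBdd F)
    (hx : ContinuousOn x (Ici 0))
    (heq : ∀ t ∈ Ici (0 : ℝ), x t = taylorPoly v k 0 t +
      fracIntegral α (fun s => (matC M).mulVec (x s) + F s) t) {t : ℝ} (ht : 0 ≤ t) :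
    x t = ∑ j ∈ Finset.range k, (PhiInit α M j t).mulVec (v j) +
      ∫ τ in (0 : ℝ)..t, (Phi α M (t - τ)).mulVec (F τ) := by
  set L := matCLM M with hL
  have hTc := continuous_taylorPoly v k 0
  have hmono : ∀ j : ℕ, LocBdd fun s : ℝ => ((s : ℂ) ^ j / (j.factorial : ℂ)) • v (j + 0) :=
    fun j => .of_continuousOn (Continuous.continuousOn (by fun_prop))
  have h1 : HasSum (fun l : ℕ => (L ^ l) (fracIntegral (α * l) (taylorPoly v k 0) t))
      (∑ j ∈ Finset.range k, (PhiInit α M j t).mulVec (v j)) := by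
    refine (hasSum_sum fun j (_ : j ∈ Finset.range k) =>
      hasSum_PhiInit_mulVec hα M j ht (v j)).congr_fun fun l => ?_
    rw [← map_sum]
    exact congrArg (L ^ l) (fracIntegral_sum (mul_natCast_eq_zero_or_re_pos hα l) _ hmono ht)
  have h2 := (intervalIntegrable_and_hasSum_Phi hα M hF ht).2
  have h3 := (h1.tendsto_sum_nat.add h2.tendsto_sum_nat).add (tendsto_iterate_remainder hα L hx ht)
  rw [add_zero] at h3
  refine tendsto_nhds_unique (tendsto_const_nhds.congr fun N => ?_) h3
  exact iterate_volterra hα L (.of_continuousOn hTc.continuousOn) hF (.of_continuousOn hx) heq N ht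

/-- Componentwise complex conjugation. -/
def conjCLM (n : ℕ) : (Fin n → ℂ) →L[ℝ] (Fin n → ℂ) :=
  ContinuousLinearMap.pi fun i =>
    (Complex.conjCLE : ℂ →L[ℝ] ℂ).comp (ContinuousLinearMap.proj i)

theorem conjCLM_apply (w : Fin n → ℂ) (i : Fin n) :
    conjCLM n w i = (starRingEnd ℂ) (w i) := rfl

theorem conjCLM_toC (w : Fin n → ℝ) : conjCLM n (toC w) = toC w := by
  ext i
  simp [conjCLM_apply, toC]

theorem conjCLM_smul (c : ℂ) (w : Fin n → ℂ) :
    conjCLM n (c • w) = (starRingEnd ℂ) c • conjCLM n w := by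
  ext i
  simp [conjCLM_apply]

theorem conjCLM_mulVec {m : ℕ} (M : Matrix (Fin n) (Fin m) ℝ) (w : Fin m → ℂ) :
    conjCLM n ((matC M).mulVec w) = (matC M).mulVec (conjCLM m w) := by
  ext i
  simp [conjCLM_apply, Matrix.mulVec, dotProduct, matC]

/-- For real α both Γ(α) and the kernel are real; t - τ ≥ 0 stays off the branch cut of the complex
power. -/
theorem fracIntegral_conj (hα : 0 < α.re) (him : α.im = 0) (hf : LocBdd f) {t : ℝ} (ht : 0 ≤ t) :
    fracIntegral α (fun s => conjCLM n (f s)) t = conjCLM n (fracIntegral α f t) := by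
  have hconj : (starRingEnd ℂ) α = α := Complex.conj_eq_iff_im.2 him
  rw [fracIntegral_eq hα, fracIntegral_eq hα, conjCLM_smul,
    ← (conjCLM n).intervalIntegral_comp_comm (hf.intervalIntegrable_kernel_smul hα ht), map_inv₀,
    ← Complex.Gamma_conj, hconj]
  congr 1
  refine intervalIntegral.integral_congr fun τ hτ => ?_
  rw [uIcc_of_le ht] at hτ
  rw [conjCLM_smul]
  congr 1
  have hnn : 0 ≤ t - τ := sub_nonneg.2 hτ.2
  have harg : ((t - τ : ℝ) : ℂ).arg ≠ Real.pi := by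
    rw [Complex.arg_ofReal_of_nonneg hnn]
    exact Real.pi_pos.ne
  have hpow := Complex.cpow_conj _ (α - 1) harg
  rwa [map_sub, map_one, hconj, Complex.conj_ofReal] at hpow

theorem conjCLM_taylorPoly (w : ℕ → Fin n → ℝ) (k j : ℕ) (t : ℝ) :
    conjCLM n (taylorPoly (fun i => toC (w i)) k j t) = taylorPoly (fun i => toC (w i)) k j t := by
  simp only [taylorPoly, map_sum]
  refine Finset.sum_congr rfl fun i _ => ?_
  rw [conjCLM_smul, conjCLM_toC]
  simp

/-- For a real order the solution of the delayed integral equation with real data is real. -/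
theorem im_eq_zero_of_volterra {m p : ℕ} {A : Fin (p + 1) → Matrix (Fin n) (Fin n) ℝ}
    {B : Matrix (Fin n) (Fin m) ℝ} {d : Fin (p + 1) → ℝ} {u : ℝ → Fin m → ℝ} {h : ℝ}
    (hα : 0 < α.re) (him : α.im = 0) (hd : ∀ i, d i ∈ Icc 0 h) (hu : LocBdd u)
    (hH : HistBdd h x) (hc : ContinuousOn x (Ici 0)) (w : ℕ → Fin n → ℝ) {k : ℕ}
    (hreal : ∀ t ∈ Ico (-h) 0, conjCLM n (x t) = x t)
    (heq : ∀ t ∈ Ici (0 : ℝ), x t = taylorPoly (fun i => toC (w i)) k 0 t +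
      fracIntegral α (systemRHS A B d u x) t) {t : ℝ} (ht : -h ≤ t) (i : Fin n) :
    (x t i).im = 0 := by
  have hRHS : LocBdd (systemRHS A B d u x) := locBdd_systemRHS hd hu hH
  suffices hz : conjCLM n (x t) = x t by
    have := congrFun hz i
    exact Complex.conj_eq_iff_im.1 this
  rcases lt_or_ge t 0 with h0 | h0
  · exact hreal t ⟨ht, h0⟩
  refine sub_eq_zero.1 (eqOn_zero_of_volterra (A := A) (z := fun s => conjCLM n (x s) - x s) hα hd
    (((conjCLM n).continuous.comp_continuousOn hc).sub hc)
    (fun s hs => sub_eq_zero.2 (hreal s hs)) (fun s hs => ?_) h0)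
  have hcR : LocBdd fun s => conjCLM n (systemRHS A B d u x s) := hRHS.clm_comp _
  have e : (fun s => ∑ i, (matC (A i)).mulVec (conjCLM n (x (s - d i)) - x (s - d i))) =
      fun s => conjCLM n (systemRHS A B d u x s) - systemRHS A B d u x s := by
    ext1 s
    rw [← systemRHS_sub (B := B) (u := u) (x := fun s => conjCLM n (x s))]
    congr 1
    simp only [systemRHS, map_add, map_sum, conjCLM_mulVec, conjCLM_toC]
  rw [e, fracIntegral_sub (Or.inr hα) hcR hRHS hs, fracIntegral_conj hα him hRHS hs]
  rw [heq s hs, map_add, conjCLM_taylorPoly]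
  abel

end

/-! ### Integrals of the representation formula and the final assembly. -/

variable {n m p : ℕ} {α : ℂ}

/-- The endpoints may exceed t, as a delay h_i can; beyond t the integrand is zero because `Phi`
vanishes at negative arguments. -/
theorem intervalIntegrable_Phi_mulVec {f : ℝ → Fin n → ℂ} (hα : 0 < α.re)
    (M : Matrix (Fin n) (Fin n) ℝ) (hf : LocBdd f) {t : ℝ} (ht : 0 ≤ t) {a b : ℝ} (ha : 0 ≤ a)
    (hb : 0 ≤ b) :
    IntervalIntegrable (fun τ => (Phi α M (t - τ)).mulVec (f τ)) volume a b := by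
  suffices h : ∀ R, 0 ≤ R →
      IntervalIntegrable (fun τ => (Phi α M (t - τ)).mulVec (f τ)) volume 0 R from
    (h a ha).symm.trans (h b hb)
  intro R hR
  have h1 := (intervalIntegrable_and_hasSum_Phi hα M hf ht).1
  refine h1.trans ?_
  rcases le_total R t with hRt | hRt
  · refine h1.symm.mono_set ?_
    rw [uIcc_of_ge hRt, uIcc_of_ge ht]
    exact Icc_subset_Icc_left hR
  · refine (intervalIntegrable_const (c := (0 : Fin n → ℂ))).congr fun τ hτ => ?_
    rw [uIoc_of_le hRt] at hτ
    simp [Phi, hτ.1]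

/-- Nothing is known about φ outside [-h, 0]; cutting it off there allows the lemmas for functions
on [-h, ∞) to be used. -/
theorem AdmissibleInitial.histBdd_indicator {h : ℝ} {φ : ℝ → Fin n → ℝ}
    (hφ : AdmissibleInitial h φ) :
    HistBdd h (fun t => toC ((Icc (-h) 0).indicator φ t)) where
  aesm := continuous_toC.comp_aestronglyMeasurable
    ((aestronglyMeasurable_indicator_iff measurableSet_Icc).2 hφ.aestronglyMeasurable).restrict
  bdd T := by
    obtain ⟨⟨M, hM⟩, -⟩ := hφ
    refine ⟨|M|, fun t _ => ?_⟩
    rw [norm_toC]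
    by_cases ht : t ∈ Icc (-h) 0
    · rw [indicator_of_mem ht]
      exact (hM t ht).trans (le_abs_self M)
    · simp [indicator_of_notMem ht]

/-- The history term of the variation of constants formula. -/
theorem intervalIntegrable_Phi_history {h c : ℝ} {φ : ℝ → Fin n → ℝ} (hα : 0 < α.re)
    (M N : Matrix (Fin n) (Fin n) ℝ) (hφ : AdmissibleInitial h φ) (hc : c ∈ Icc 0 h) {t : ℝ}
    (ht : 0 ≤ t) :
    IntervalIntegrable (fun τ => (Phi α M (t - τ)).mulVec
      ((matC N).mulVec (toC (φ (τ - c))))) volume 0 c := by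
  refine (intervalIntegrable_Phi_mulVec hα M ((hφ.histBdd_indicator.locBdd_shift hc).mulVec N) ht
    le_rfl hc.1).congr fun τ hτ => ?_
  rw [uIoc_of_le hc.1] at hτ
  have : τ - c ∈ Icc (-h) 0 := ⟨by linarith [hτ.1, hc.2], by linarith [hτ.2]⟩
  simp only [indicator_of_mem this]

theorem aestronglyMeasurable_sum_toC {h : ℝ} {k : ℕ} {φ : Fin k → ℝ → Fin n → ℝ}
    (hφ : ∀ j, AdmissibleInitial h (φ j)) :
    AEStronglyMeasurable (fun t => ∑ j, toC (φ j t)) (volume.restrict (Ico (-h) 0)) :=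
  Finset.aestronglyMeasurable_fun_sum _ fun j _ => continuous_toC.comp_aestronglyMeasurable
    ((hφ j).aestronglyMeasurable.mono_measure (Measure.restrict_mono Ico_subset_Icc_self le_rfl))

theorem exists_bound_sum_toC {h : ℝ} {k : ℕ} {φ : Fin k → ℝ → Fin n → ℝ}
    (hφ : ∀ j, AdmissibleInitial h (φ j)) :
    ∃ M, ∀ t ∈ Ico (-h) 0, ‖∑ j, toC (φ j t)‖ ≤ M := by
  choose M hM using fun j => (hφ j).1
  refine ⟨∑ j, M j, fun t ht => (norm_sum_le _ _).trans (Finset.sum_le_sum fun j _ => ?_)⟩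
  rw [norm_toC]
  exact hM j t (Ico_subset_Icc_self ht)

/-- Two solutions of the delayed integral equation with the same data agree. -/
theorem eqOn_of_volterra {A : Fin (p + 1) → Matrix (Fin n) (Fin n) ℝ}
    {B : Matrix (Fin n) (Fin m) ℝ} {d : Fin (p + 1) → ℝ} {u : ℝ → Fin m → ℝ} {h : ℝ}
    {x y T : ℝ → Fin n → ℂ} (hα : 0 < α.re) (hd : ∀ i, d i ∈ Icc 0 h)
    (hu : LocBdd u) (hx : HistBdd h x) (hy : HistBdd h y) (hxc : ContinuousOn x (Ici 0))
    (hyc : ContinuousOn y (Ici 0)) (hhist : EqOn y x (Ico (-h) 0))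
    (hxe : ∀ t ∈ Ici (0 : ℝ), x t = T t + fracIntegral α (systemRHS A B d u x) t)
    (hye : ∀ t ∈ Ici (0 : ℝ), y t = T t + fracIntegral α (systemRHS A B d u y) t) :
    EqOn y x (Ici (-h)) := by
  intro t ht
  rcases lt_or_ge t 0 with h0 | h0
  · exact hhist ⟨ht, h0⟩
  refine sub_eq_zero.1 (eqOn_zero_of_volterra (A := A) (z := fun s => y s - x s) hα hd
    (hyc.sub hxc) (fun s hs => sub_eq_zero.2 (hhist hs)) (fun s hs => ?_) h0)
  simp only [← systemRHS_sub (B := B) (u := u)]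
  rw [fracIntegral_sub (Or.inr hα) (locBdd_systemRHS hd hu hy) (locBdd_systemRHS hd hu hx) hs,
    hxe s hs, hye s hs]
  abel

end CaputoDelay

end

theorem theorem3p1 {n m p : ℕ} (α : ℂ) (hα : CaputoDelay.AdmissibleOrder α)
    (A : Fin (p + 1) → Matrix (Fin n) (Fin n) ℝ) (B : Matrix (Fin n) (Fin m) ℝ)
    (d : Fin (p + 1) → ℝ) (hd0 : d 0 = 0) (hd : StrictMono d)
    (φ : Fin (CaputoDelay.caputoIndex α) → ℝ → Fin n → ℝ)
    (hφ : ∀ j, CaputoDelay.AdmissibleInitial (d (Fin.last p)) (φ j))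
    (u : ℝ → Fin m → ℝ) (hu : CaputoDelay.BoundedPiecewiseContinuous u) :
    -- the Mittag-Leffler series in the kernels converge
    (∀ t : ℝ, 0 ≤ t →
      (∀ j : Fin (CaputoDelay.caputoIndex α), Summable
        (CaputoDelay.mittagLefflerTerm α ((j : ℂ) + 1) (CaputoDelay.scaledMatrix α (A 0) t))) ∧
      Summable (CaputoDelay.mittagLefflerTerm α α (CaputoDelay.scaledMatrix α (A 0) t))) ∧
    ∃ x : ℝ → Fin n → ℂ,
      -- existence
      CaputoDelay.IsSolution α A B d φ u x ∧
      -- uniqueness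
      (∀ y : ℝ → Fin n → ℂ, CaputoDelay.IsSolution α A B d φ u y →
        EqOn y x (Ici (-d (Fin.last p)))) ∧
      -- the equation holds at each point of continuity of its right-hand side
      (∀ t : ℝ, 0 < t → ContinuousAt (CaputoDelay.systemRHS A B d u x) t →
        CaputoDelay.HasCaputoDerivAt α x (CaputoDelay.systemRHS A B d u x t) t) ∧
      -- the solution is real for a real order
      (α.im = 0 → ∀ t : ℝ, -d (Fin.last p) ≤ t → ∀ i, (x t i).im = 0) ∧
      -- the variation-of-constants formula, with integrals that exist
      ∀ t : ℝ, 0 ≤ t →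
        (∀ (j : Fin (CaputoDelay.caputoIndex α)) (i : Fin p), IntervalIntegrable
          (fun τ => (CaputoDelay.Phi α (A 0) (t - τ)).mulVec
            ((CaputoDelay.matC (A i.succ)).mulVec (CaputoDelay.toC (φ j (τ - d i.succ)))))
          volume 0 (d i.succ)) ∧
        (∀ i : Fin p, IntervalIntegrable
          (fun τ => (CaputoDelay.Phi α (A 0) (t - τ)).mulVec
            ((CaputoDelay.matC (A i.succ)).mulVec (x (τ - d i.succ))))
          volume (d i.succ) t) ∧
        IntervalIntegrable
          (fun τ => (CaputoDelay.Phi α (A 0) (t - τ)).mulVec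
            ((CaputoDelay.matC B).mulVec (CaputoDelay.toC (u τ))))
          volume 0 t ∧
        x t =
          (∑ j : Fin (CaputoDelay.caputoIndex α),
            ((CaputoDelay.PhiInit α (A 0) j t).mulVec (CaputoDelay.toC (φ j 0)) +
              ∑ i : Fin p, ∫ τ in (0 : ℝ)..(d i.succ),
                (CaputoDelay.Phi α (A 0) (t - τ)).mulVec
                  ((CaputoDelay.matC (A i.succ)).mulVec
                    (CaputoDelay.toC (φ j (τ - d i.succ)))))) +
          (∑ i : Fin p, ∫ τ in (d i.succ)..t,
            (CaputoDelay.Phi α (A 0) (t - τ)).mulVec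
              ((CaputoDelay.matC (A i.succ)).mulVec (x (τ - d i.succ)))) +
          ∫ τ in (0 : ℝ)..t,
            (CaputoDelay.Phi α (A 0) (t - τ)).mulVec
              ((CaputoDelay.matC B).mulVec (CaputoDelay.toC (u τ))) := by
  obtain ⟨k, hk, hm, hκ⟩ := CaputoDelay.caputoIndex_spec hα
  have hαre := hα.re_pos
  set h := d (Fin.last p) with hh
  have hdI : ∀ i, d i ∈ Icc 0 h := fun i =>
    ⟨hd0 ▸ hd.monotone (Fin.zero_le i), hd.monotone (Fin.le_last i)⟩
  refine ⟨fun t _ => ⟨fun j => CaputoDelay.summable_mittagLefflerTerm hαre (by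
    simp only [Complex.add_re, Complex.natCast_re, Complex.one_re]
    positivity) _, CaputoDelay.summable_mittagLefflerTerm hαre hαre _⟩, ?_⟩
  have huL := hu.locBdd
  obtain ⟨Mu, hMu⟩ := hu.bounded
  have hψ := CaputoDelay.aestronglyMeasurable_sum_toC hφ
  obtain ⟨M, hM⟩ := CaputoDelay.exists_bound_sum_toC hφ
  set w : ℕ → Fin n → ℝ :=
    fun j => if hj : j < CaputoDelay.caputoIndex α then φ ⟨j, hj⟩ 0 else 0 with hw
  have hwφ : ∀ j : Fin (CaputoDelay.caputoIndex α), w j = φ j 0 := fun j => by simp [hw]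
  set v : ℕ → Fin n → ℂ := fun j => CaputoDelay.toC (w j) with hv
  have hv0 : ∀ j, k < j → v j = 0 := by
    intro j hj
    have : ¬ j < CaputoDelay.caputoIndex α := by omega
    ext i
    simp [hv, hw, this, CaputoDelay.toC]
  obtain ⟨x, hxhist, hxc, hxe⟩ := CaputoDelay.exists_volterra (A := A) (B := B) hαre hdI huL hMu
    hψ hM v (k + 1)
  have hxhist' : EqOn x (fun t => ∑ j, CaputoDelay.toC (φ j t)) (Ico (-h) 0) :=
    hxhist.mono fun t ht => ht.2
  have hxH : CaputoDelay.HistBdd h x := .of_history hψ hM hxhist' hxc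
  have H : CaputoDelay.IsVolterra α k v (CaputoDelay.systemRHS A B d u x) x :=
    ⟨hk, hm, hκ, CaputoDelay.locBdd_systemRHS hdI huL hxH, hv0, hxe⟩
  refine ⟨x, ⟨hxhist', H.caputoRegular, fun j => ?_, H.ae_hasCaputoDerivAt⟩, fun y hy => ?_,
    fun t ht hc => H.hasCaputoDerivAt ht hc, fun him t ht i => ?_, fun t ht => ?_⟩
  · rw [H.derivHalfLine_eq (by omega), hv]
    simp only [hwφ]
  · have hyc : ContinuousOn y (Ici 0) := hy.regular.contDiffOn.continuousOn
    have hyH : CaputoDelay.HistBdd h y := .of_history hψ hM hy.history hyc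
    -- Any solution satisfies the Volterra equation, and its initial conditions force the same
    -- polynomial coefficients as those of x.
    have Hy := hy.regular.isVolterra hk hm hκ (CaputoDelay.locBdd_systemRHS hdI huL hyH) hy.equation
    have hvy : (fun j => if j ≤ k then CaputoDelay.derivHalfLine j y 0 else 0) = v := by
      ext1 j
      split_ifs with hj
      · have hj' : j < CaputoDelay.caputoIndex α := by omega
        rw [hy.initial ⟨j, hj'⟩, ← hwφ]
      · exact (hv0 j (by omega)).symm
    rw [hvy] at Hy
    exact CaputoDelay.eqOn_of_volterra hαre hdI huL hxH hyH hxc hyc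
      (fun t ht => (hy.history t ht).trans (hxhist' ht).symm) hxe Hy.eq
  · refine CaputoDelay.im_eq_zero_of_volterra hαre him hdI huL hxH hxc w (fun t ht => ?_) hxe ht i
    rw [hxhist' ht]
    simp only [map_sum, CaputoDelay.conjCLM_toC]
  · have hI1 := fun (j : Fin (CaputoDelay.caputoIndex α)) (i : Fin p) =>
      CaputoDelay.intervalIntegrable_Phi_history hαre (A 0) (A i.succ) (hφ j) (hdI i.succ) ht
    have hDel : ∀ i : Fin p, CaputoDelay.LocBdd fun τ =>
        (CaputoDelay.matC (A i.succ)).mulVec (x (τ - d i.succ)) := fun i =>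
      (hxH.locBdd_shift (hdI i.succ)).mulVec (A i.succ)
    have hCon : CaputoDelay.LocBdd fun τ =>
        (CaputoDelay.matC B).mulVec (CaputoDelay.toC (u τ)) :=
      (CaputoDelay.locBdd_toC huL).mulVec B
    have hI2 : ∀ (i : Fin p) {a b : ℝ}, 0 ≤ a → 0 ≤ b → IntervalIntegrable
        (fun τ => (CaputoDelay.Phi α (A 0) (t - τ)).mulVec
          ((CaputoDelay.matC (A i.succ)).mulVec (x (τ - d i.succ)))) volume a b := fun i _ _ =>
      CaputoDelay.intervalIntegrable_Phi_mulVec hαre (A 0) (hDel i) ht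
    have hI3 := CaputoDelay.intervalIntegrable_Phi_mulVec hαre (A 0) hCon ht le_rfl ht
    refine ⟨hI1, fun i => hI2 i (hdI i.succ).1 ht, hI3, ?_⟩
    have hF := (CaputoDelay.LocBdd.sum Finset.univ fun i _ => hDel i).add hCon
    have hRHS : CaputoDelay.systemRHS A B d u x = fun s => (CaputoDelay.matC (A 0)).mulVec (x s) +
        (∑ i : Fin p, (CaputoDelay.matC (A i.succ)).mulVec (x (s - d i.succ)) +
          (CaputoDelay.matC B).mulVec (CaputoDelay.toC (u s))) := by
      ext1 s
      rw [CaputoDelay.systemRHS, Fin.sum_univ_succ, hd0, sub_zero, add_assoc]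
    rw [hRHS] at hxe
    -- For τ < h_i the delayed state is the history ∑ φ_j. The oriented splitting at h_i is valid
    -- also when h_i > t.
    have hsplit : ∀ i : Fin p, ∫ τ in (0 : ℝ)..t, (CaputoDelay.Phi α (A 0) (t - τ)).mulVec
          ((CaputoDelay.matC (A i.succ)).mulVec (x (τ - d i.succ))) =
        (∑ j, ∫ τ in (0 : ℝ)..(d i.succ), (CaputoDelay.Phi α (A 0) (t - τ)).mulVec
          ((CaputoDelay.matC (A i.succ)).mulVec (CaputoDelay.toC (φ j (τ - d i.succ))))) +
        ∫ τ in (d i.succ)..t, (CaputoDelay.Phi α (A 0) (t - τ)).mulVec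
          ((CaputoDelay.matC (A i.succ)).mulVec (x (τ - d i.succ))) := by
      intro i
      have hdi := hdI i.succ
      rw [← intervalIntegral.integral_add_adjacent_intervals (hI2 i le_rfl hdi.1) (hI2 i hdi.1 ht),
        ← intervalIntegral.integral_finsetSum fun j _ => hI1 j i]
      congr 1
      -- The endpoint τ = h_i is discarded: there the delayed state is x(0) = φ_0(0), which need not
      -- be ∑ φ_j(0).
      rw [intervalIntegral.integral_of_le hdi.1, intervalIntegral.integral_of_le hdi.1,
        integral_Ioc_eq_integral_Ioo, integral_Ioc_eq_integral_Ioo]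
      refine setIntegral_congr_fun measurableSet_Ioo fun τ hτ => ?_
      rw [hxhist' ⟨by linarith [hτ.1, hdi.2], by linarith [hτ.2]⟩]
      simp only [Matrix.mulVec_sum]
    have hsumI : IntervalIntegrable (fun τ => ∑ i : Fin p,
        (CaputoDelay.Phi α (A 0) (t - τ)).mulVec
          ((CaputoDelay.matC (A i.succ)).mulVec (x (τ - d i.succ)))) volume 0 t := by
      simpa only [Finset.sum_fn] using
        IntervalIntegrable.sum Finset.univ fun i _ => hI2 i le_rfl ht
    rw [CaputoDelay.variation_of_constants hαre (A 0) hF hxc hxe ht, ← hk, Finset.sum_range]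
    simp only [Matrix.mulVec_add, Matrix.mulVec_sum, hv, hwφ]
    rw [intervalIntegral.integral_add hsumI hI3,
      intervalIntegral.integral_finsetSum fun i _ => hI2 i le_rfl ht]
    simp only [hsplit, Finset.sum_add_distrib]
    rw [Finset.sum_comm (s := (Finset.univ : Finset (Fin p)))]
    abel
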